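/- Consider a WLAN with $N\ge 1$ stations whose channel can accommodate up to $M\ge 1$ simultaneous transmissions. Each station transmits in a generic slot with probability $\tau\in[0,1]$; idle, collision and success slots have lengths $T_{idle},T_{coll},T_{succ}>0$; packets arrive at a tagged station as a Poisson process of rate $\lambda>0$. The minimum contention window is an integer $W_0\ge 1$, the backoff factor is a real number $r>1$, and the contention window after $i$ failures of a packet is $W_i=r^iW_0$ (rounded to one of the two neighbouring integers when it is not an integer). Let $$p_c=1-\sum_{k=0}^{M-1}\binom{N-1}{k}\tau^k(1-\tau)^{N-1-k}$$ be the collision probability, and assume $p_c<1$. Let $L$ be the random length of a slot in which the tagged station does not transmit: $L$ equals $T_{idle}$, $T_{succ}$, $T_{coll}$ with respective probabilities $$(1-\tau)^{N-1},\qquad \sum_{k=1}^{M}\binom{N-1}{k}\tau^k(1-\tau)^{N-1-k},\qquad 1-\sum_{k=0}^{M}\binom{N-1}{k}\tau^k(1-\tau)^{N-1-k}.$$ Let $$X_{ne}=\sum_{i=1}^{R}\sum_{m=1}^{B_i}L_{i,m}+(R-1)T_{coll}+T_{succ},$$ where all the variables are independent, $\Pr\{R=j\}=p_c^{j-1}(1-p_c)$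 for $j\ge1$, $B_i$ is uniform on $\{0,\dots,W_{i-1}-1\}$, and the $L_{i,m}$ are distributed as $L$. Put $\tilde\rho=\lambda\,\mathrm{E}[X_{ne}]\in(0,\infty]$. The tagged station is the first-come-first-served M/G/1 queue with multiple vacations, with arrival rate $\lambda$, i.i.d. service times distributed as $X_{ne}$ and i.i.d. vacations distributed as $L$, arrivals, services and vacations being independent: whenever the queue becomes empty the server takes vacations one after another until, at the end of one of them, a packet is waiting, and then it starts to serve. Let $D$ be the steady-state packet delay (time from the arrival of a packet to the end of its service); that is, the law of $D$ is a probability law on $[0,\infty)$ such that, if one packet's delay has this law, so does the delay of the next packet. Then such a law is unique if it exists, and it exists if and only if $\tilde\rho<1$. The mean packet delay $\mathrm{E}[D]$ is finite (that is, $D$ exists and $\mathrm{E}[D]<\infty$) if and only if $\tilde\rho<1$ and $p_c<1/r^2$. The delay jitter $\mathrm{Var}[D]$ is finite (that is, $D$ exists and $\mathrm{Var}[D]<\infty$) if and only if $\tilde\rho<1$ and $p_c<1/r^3$. -/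

import Mathlib

open MeasureTheory ProbabilityTheory
open scoped ENNReal

noncomputable section

namespace MPRWLAN

/-- Probability that exactly `k` of `n` stations transmit in a slot, when each of them transmits
independently with probability `τ`. -/
def binomWeight (n : ℕ) (τ : ℝ) (k : ℕ) : ℝ :=
  (n.choose k : ℝ) * τ ^ k * (1 - τ) ^ (n - k)

/-- The probability that a transmission of the tagged station collides: at least `M` of the `N - 1`
other stations transmit in the same slot. -/
def collisionProb (N M : ℕ) (τ : ℝ) : ℝ :=
  1 - ∑ k ∈ Finset.range M, binomWeight (N - 1) τ k

/-- The parameters of an exponential-backoff WLAN with multipacket reception. -/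
structure Network where
  /-- number of stations -/
  N : ℕ
  /-- number of simultaneous transmissions that the channel can accommodate -/
  M : ℕ
  /-- probability that a station transmits in a generic slot -/
  τ : ℝ
  /-- packet arrival rate at a station -/
  rate : ℝ
  /-- lengths of idle, collision and success slots -/
  Tidle : ℝ
  Tcoll : ℝ
  Tsucc : ℝ
  /-- backoff factor -/
  r : ℝ
  /-- minimum contention window -/
  W₀ : ℕ
  /-- `window i` is the contention window, a whole number of slots, after `i` failures of a packet -/
  window : ℕ → ℕ
  N_pos : 1 ≤ N
  M_pos : 1 ≤ M
  τ_nonneg : 0 ≤ τ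
  τ_le_one : τ ≤ 1
  /-- a packet is eventually transmitted -/
  collisionProb_lt_one : collisionProb N M τ < 1
  rate_pos : 0 < rate
  Tidle_pos : 0 < Tidle
  Tcoll_pos : 0 < Tcoll
  Tsucc_pos : 0 < Tsucc
  one_lt_r : 1 < r
  W₀_pos : 1 ≤ W₀
  /-- The window is `r ^ i * W₀`, rounded in either direction where that is not an integer (and
  hence exactly `r ^ i * W₀` where it is one). -/
  window_spec : ∀ i, |(window i : ℝ) - r ^ i * W₀| < 1

lemma binomWeight_nonneg {n : ℕ} {τ : ℝ} (h0 : 0 ≤ τ) (h1 : τ ≤ 1) (k : ℕ) :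
    0 ≤ binomWeight n τ k := by
  have : 0 ≤ 1 - τ := by linarith
  unfold binomWeight
  positivity

lemma sum_binomWeight_le_one {n : ℕ} {τ : ℝ} (h0 : 0 ≤ τ) (h1 : τ ≤ 1) (m : ℕ) :
    ∑ k ∈ Finset.range m, binomWeight n τ k ≤ 1 := by
  have hfull : ∑ k ∈ Finset.range (n + 1), binomWeight n τ k = 1 := by
    have h := add_pow τ (1 - τ) n
    rw [add_sub_cancel, one_pow] at h
    rw [h]
    refine Finset.sum_congr rfl fun k _ => ?_
    unfold binomWeight
    ring
  have hz : ∀ k ∈ Finset.range (n + 1 + m), k ∉ Finset.range (n + 1) → binomWeight n τ k = 0 := by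
    intro k _ hk
    have : n < k := by simpa using hk
    simp [binomWeight, Nat.choose_eq_zero_of_lt this]
  rw [← hfull, Finset.sum_subset (Finset.range_mono (Nat.le_add_right (n + 1) m)) hz]
  exact Finset.sum_le_sum_of_subset_of_nonneg (Finset.range_mono (by omega))
    fun k _ _ => binomWeight_nonneg h0 h1 k

namespace Network

variable (S : Network)

/-- The collision probability `p_c`. -/
def pc : ℝ := collisionProb S.N S.M S.τ

lemma pc_nonneg : 0 ≤ S.pc := by
  have := sum_binomWeight_le_one (n := S.N - 1) S.τ_nonneg S.τ_le_one S.M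
  unfold pc collisionProb
  linarith

/-- Probabilities that a slot in which the tagged station does not transmit is idle, a collision,
or a success. -/
def Pidle : ℝ := (1 - S.τ) ^ (S.N - 1)

def Pcoll : ℝ := 1 - ∑ k ∈ Finset.range (S.M + 1), binomWeight (S.N - 1) S.τ k

def Psucc : ℝ := ∑ k ∈ Finset.Icc 1 S.M, binomWeight (S.N - 1) S.τ k

lemma Pidle_nonneg : 0 ≤ S.Pidle := pow_nonneg (by linarith [S.τ_le_one]) _

lemma Pcoll_nonneg : 0 ≤ S.Pcoll := by
  have := sum_binomWeight_le_one (n := S.N - 1) S.τ_nonneg S.τ_le_one (S.M + 1)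
  unfold Pcoll
  linarith

lemma Psucc_nonneg : 0 ≤ S.Psucc :=
  Finset.sum_nonneg fun k _ => binomWeight_nonneg S.τ_nonneg S.τ_le_one k

lemma P_sum : S.Pidle + S.Pcoll + S.Psucc = 1 := by
  have h : ∑ k ∈ Finset.range (S.M + 1), binomWeight (S.N - 1) S.τ k = S.Pidle + S.Psucc := by
    have h' : Finset.range (S.M + 1) = insert 0 (Finset.Icc 1 S.M) := by
      ext k
      simp only [Finset.mem_range, Finset.mem_insert, Finset.mem_Icc]
      omega
    rw [h', Finset.sum_insert (by simp)]
    simp [binomWeight, Pidle, Psucc]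
  unfold Pcoll
  rw [h]
  ring

/-- The law of the length `L` of a slot in which the tagged station does not transmit. This is the
law both of a countdown slot and of a vacation. -/
def slotLaw : Measure ℝ :=
  ENNReal.ofReal S.Pidle • Measure.dirac S.Tidle +
    ENNReal.ofReal S.Pcoll • Measure.dirac S.Tcoll +
      ENNReal.ofReal S.Psucc • Measure.dirac S.Tsucc

instance : IsProbabilityMeasure S.slotLaw := by
  constructor
  simp only [slotLaw, Measure.add_apply, Measure.smul_apply, measure_univ, smul_eq_mul, mul_one]
  rw [← ENNReal.ofReal_add S.Pidle_nonneg S.Pcoll_nonneg,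
    ← ENNReal.ofReal_add (add_nonneg S.Pidle_nonneg S.Pcoll_nonneg) S.Psucc_nonneg, S.P_sum,
    ENNReal.ofReal_one]

lemma window_pos (i : ℕ) : 0 < S.window i := by
  have h := (abs_lt.mp (S.window_spec i)).1
  have h1 : (1 : ℝ) ≤ S.r ^ i := one_le_pow₀ S.one_lt_r.le
  have h2 : (1 : ℝ) ≤ S.W₀ := by exact_mod_cast S.W₀_pos
  have h3 : (1 : ℝ) ≤ S.r ^ i * S.W₀ := one_le_mul_of_one_le_of_one_le h1 h2
  have h4 : (0 : ℝ) < S.window i := by linarith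
  exact_mod_cast h4

/-- The law of the number of countdown slots in the backoff period that follows the `i`-th failure:
uniform on `{0, …, window i - 1}`. -/
def backoffLaw (i : ℕ) : Measure ℕ := uniformOn (Set.Iio (S.window i))

instance (i : ℕ) : IsProbabilityMeasure (S.backoffLaw i) :=
  isProbabilityMeasure_uniformOn (Set.finite_Iio _) ⟨0, S.window_pos i⟩

/-- The law of the number of failed transmissions of a packet: `j` with probability
`p_c ^ j * (1 - p_c)`. -/
def failureLaw : Measure ℕ :=
  geometricMeasure ⟨1 - S.pc, by
    have : S.pc < 1 := S.collisionProb_lt_one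
    linarith, by linarith [S.pc_nonneg]⟩

instance : IsProbabilityMeasure S.failureLaw := isProbabilityMeasure_geometricMeasure

/-- The medium-access delay of a packet that arrives at a non-empty queue, when its transmission
fails `j` times before it succeeds, its `i`-th backoff period (counted from `0`) has `b i` slots,
and the `m`-th of these has length `l i m`. -/
def accessDelay (j : ℕ) (b : ℕ → ℕ) (l : ℕ → ℕ → ℝ) : ℝ :=
  (∑ i ∈ Finset.range (j + 1), ∑ m ∈ Finset.range (b i), l i m) + j * S.Tcoll + S.Tsucc

/-- The law of the medium-access delay `X_ne`: the number of failures, the backoff counters and the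
slot lengths are all independent. -/
def accessLaw : Measure ℝ :=
  (S.failureLaw.prod ((Measure.infinitePi S.backoffLaw).prod
    (Measure.infinitePi fun _ : ℕ => Measure.infinitePi fun _ : ℕ => S.slotLaw))).map
      fun ω => S.accessDelay ω.1 ω.2.1 ω.2.2

/-- `ρ̃ = λ E[X_ne]`, which may be `∞`. -/
def rhoTilde : ℝ≥0∞ :=
  ENNReal.ofReal S.rate * ∫⁻ x, ENNReal.ofReal x ∂S.accessLaw

end Network

/-- The first time, not before `u`, at which a vacation ends, when consecutive vacations of lengths
`v 0, v 1, …` are taken from time `0` on. -/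
def vacationEnd (v : ℕ → ℝ) (u : ℝ) : ℝ :=
  ∑ k ∈ Finset.range (sInf {n : ℕ | u ≤ ∑ k ∈ Finset.range n, v k}), v k

/-- The delay (time from arrival to end of service) of a packet in a first-come-first-served queue
with multiple vacations, when the preceding packet has delay `d`, the packet arrives a time `t`
after the preceding one, its service time is `x`, and `v` are the lengths of the vacations that the
server takes if the queue becomes empty.

Time is counted from the arrival of the preceding packet, which leaves at `d`. If the packet has
arrived by then, its service starts at `d`; otherwise the server takes vacations from `d` on, and
the service starts at the end of the vacation during which the packet arrives. -/
def nextDelay (d t x : ℝ) (v : ℕ → ℝ) : ℝ :=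
  (if t ≤ d then d else d + vacationEnd v (t - d)) + x - t

namespace Network

variable (S : Network)

/-- `μ` is a steady-state law of the packet delay `D` in the M/G/1 queue with multiple vacations,
with Poisson arrivals of rate `λ`, service times distributed as `X_ne` and vacations distributed
as `L`: if the delay of a packet has law `μ`, then so does the delay of the next packet. -/
structure IsSteadyStateDelay (μ : Measure ℝ) : Prop where
  isProbabilityMeasure : IsProbabilityMeasure μ
  nonneg : ∀ᵐ d ∂μ, 0 ≤ d
  stationary :
    (μ.prod ((expMeasure S.rate).prod (S.accessLaw.prod
      (Measure.infinitePi fun _ : ℕ => S.slotLaw)))).map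
        (fun ω => nextDelay ω.1 ω.2.1 ω.2.2.1 ω.2.2.2) = μ

end Network

end MPRWLAN

end

/-! Conditioning on whether the next packet finds the queue empty (an exponential interarrival time
is memoryless) turns stationarity of the delay law `μ` into an equation for Laplace transforms,
which away from `s = λ` is the renewal equation `μ = κ * μ + c σ`. Here `κ`, of mass `ρ̃`, is `λ`
times the integrated tail of `X_ne`, and `σ` comes from the packets that arrive during a vacation.
Comparing masses forces `ρ̃ < 1`, and then the Pollaczek–Khinchine geometric compound of `κ`,
convolved with `σ`, is the only probability solution.

Integrating the tail costs one moment, so the `k`-th moment of the delay is finite if and only if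
the `(k + 1)`-st moment of `X_ne` is. A packet fails `j` times with probability `(1 - p_c) p_c ^ j`
and its backoff is then of order `r ^ j`, both as an upper bound and, with probability at least
`1 / 2`, as a lower bound; so the `k`-th moment of `X_ne` is finite if and only if `p_c r ^ k < 1`.
-/

noncomputable section

namespace MPRWLAN

open Filter Topology Set

/-- The Laplace transform of a measure on the line, with values in `[0, ∞]`. -/
def laplace (μ : Measure ℝ) (s : ℝ) : ℝ≥0∞ := ∫⁻ x, ENNReal.ofReal (Real.exp (-(s * x))) ∂μ

lemma laplace_zero (μ : Measure ℝ) : laplace μ 0 = μ univ := by simp [laplace]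

lemma laplace_add (μ ν : Measure ℝ) (s : ℝ) :
    laplace (μ + ν) s = laplace μ s + laplace ν s := lintegral_add_measure _ _ _

lemma laplace_smul (c : ℝ≥0∞) (μ : Measure ℝ) (s : ℝ) :
    laplace (c • μ) s = c * laplace μ s := lintegral_smul_measure _ _

lemma laplace_conv (μ ν : Measure ℝ) [SFinite ν] (s : ℝ) :
    laplace (μ.conv ν) s = laplace μ s * laplace ν s := by
  have exp_add (x y : ℝ) : ENNReal.ofReal (Real.exp (-(s * (x + y)))) =
      ENNReal.ofReal (Real.exp (-(s * x))) * ENNReal.ofReal (Real.exp (-(s * y))) := by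
    rw [← ENNReal.ofReal_mul (Real.exp_pos _).le, ← Real.exp_add, mul_add, neg_add]
  calc laplace (μ.conv ν) s
      = ∫⁻ x, ∫⁻ y, ENNReal.ofReal (Real.exp (-(s * x))) *
          ENNReal.ofReal (Real.exp (-(s * y))) ∂ν ∂μ := by
        rw [laplace, Measure.lintegral_conv (by fun_prop)]
        simp only [exp_add]
    _ = ∫⁻ x, ENNReal.ofReal (Real.exp (-(s * x))) * laplace ν s ∂μ :=
        lintegral_congr fun x => lintegral_const_mul _ (by fun_prop)
    _ = laplace μ s * laplace ν s := lintegral_mul_const _ (by fun_prop)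

lemma laplace_le_measure_univ {μ : Measure ℝ} (hμ : ∀ᵐ x ∂μ, 0 ≤ x) {s : ℝ} (hs : 0 ≤ s) :
    laplace μ s ≤ μ univ := by
  rw [← lintegral_one]
  refine lintegral_mono_ae ?_
  filter_upwards [hμ] with x hx
  rw [ENNReal.ofReal_le_one, Real.exp_le_one_iff, neg_nonpos]
  exact mul_nonneg hs hx

lemma laplace_ne_top {μ : Measure ℝ} [IsFiniteMeasure μ] (hμ : ∀ᵐ x ∂μ, 0 ≤ x) {s : ℝ}
    (hs : 0 ≤ s) : laplace μ s ≠ ∞ :=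
  ((laplace_le_measure_univ hμ hs).trans_lt (measure_lt_top μ univ)).ne

lemma laplace_pos (μ : Measure ℝ) [NeZero μ] (s : ℝ) : 0 < laplace μ s := by
  have support_eq : Function.support (fun x : ℝ => ENNReal.ofReal (Real.exp (-(s * x)))) = univ :=
    eq_univ_of_forall fun x => (ENNReal.ofReal_pos.mpr (Real.exp_pos _)).ne'
  rw [laplace, lintegral_pos_iff_support (by fun_prop), support_eq]
  exact Measure.measure_univ_pos.mpr (NeZero.ne μ)

lemma tendsto_laplace_measure_univ {μ : Measure ℝ} (hμ : ∀ᵐ x ∂μ, 0 ≤ x) :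
    Tendsto (fun n : ℕ => laplace μ (1 / ((n : ℝ) + 1))) atTop (𝓝 (μ univ)) := by
  rw [← lintegral_one]
  refine lintegral_tendsto_of_tendsto_of_monotone (fun n => by fun_prop) ?_ ?_
  · filter_upwards [hμ] with x hx n m hnm
    refine ENNReal.ofReal_le_ofReal (Real.exp_le_exp.mpr (neg_le_neg ?_))
    gcongr
  · refine ae_of_all _ fun x => ?_
    have h : Tendsto (fun n : ℕ => Real.exp (-(1 / ((n : ℝ) + 1) * x))) atTop
        (𝓝 (Real.exp (-(0 * x)))) :=
      (Real.continuous_exp.tendsto _).comp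
        ((tendsto_one_div_add_atTop_nhds_zero_nat.mul_const x).neg)
    simpa using ENNReal.tendsto_ofReal h

lemma ext_of_integral_pow_eq {μ ν : Measure ℝ} [IsFiniteMeasure μ] [IsFiniteMeasure ν] {a b : ℝ}
    (hμ : ∀ᵐ x ∂μ, x ∈ Icc a b) (hν : ∀ᵐ x ∂ν, x ∈ Icc a b)
    (h : ∀ k : ℕ, ∫ x, x ^ k ∂μ = ∫ x, x ^ k ∂ν) : μ = ν := by
  have integrable_of_continuous {ρ : Measure ℝ} [IsFiniteMeasure ρ] (hρ : ∀ᵐ x ∂ρ, x ∈ Icc a b)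
      {f : ℝ → ℝ} (hf : Continuous f) : Integrable f ρ := by
    rw [← Measure.restrict_eq_self_of_ae_mem hρ]
    exact hf.continuousOn.integrableOn_compact isCompact_Icc
  have integral_eval_eq (p : Polynomial ℝ) : ∫ x, p.eval x ∂μ = ∫ x, p.eval x ∂ν := by
    simp only [Polynomial.eval_eq_sum_range]
    rw [integral_finsetSum _ fun k _ => integrable_of_continuous hμ (by fun_prop),
      integral_finsetSum _ fun k _ => integrable_of_continuous hν (by fun_prop)]
    simp only [integral_const_mul, h]
  refine ext_of_forall_integral_eq_of_IsFiniteMeasure fun f => ?_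
  have dist_integral_eval_le {ρ : Measure ℝ} [IsFiniteMeasure ρ] (hρ : ∀ᵐ x ∂ρ, x ∈ Icc a b)
      {p : Polynomial ℝ} {ε : ℝ} (hp : ∀ x ∈ Icc a b, |p.eval x - f x| < ε) :
      dist (∫ x, p.eval x ∂ρ) (∫ x, f x ∂ρ) ≤ ε * ρ.real univ := by
    rw [dist_eq_norm, ← integral_sub (integrable_of_continuous hρ p.continuous)
      (integrable_of_continuous hρ f.continuous)]
    exact norm_integral_le_of_norm_le_const (hρ.mono fun x hx => (hp x hx).le)
  have mass_pos : 0 < μ.real univ + ν.real univ + 1 := by positivity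
  refine eq_of_forall_dist_le fun ε hε => ?_
  obtain ⟨p, hp⟩ := exists_polynomial_near_of_continuousOn a b f f.continuous.continuousOn
    (ε / (μ.real univ + ν.real univ + 1)) (by positivity)
  calc dist (∫ x, f x ∂μ) (∫ x, f x ∂ν)
      ≤ dist (∫ x, p.eval x ∂μ) (∫ x, f x ∂μ) + dist (∫ x, p.eval x ∂ν) (∫ x, f x ∂ν) := by
        rw [integral_eval_eq p]
        exact dist_triangle_left _ _ _
    _ ≤ ε / (μ.real univ + ν.real univ + 1) * (μ.real univ + ν.real univ + 1) := by
        have := dist_integral_eval_le hμ hp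
        have := dist_integral_eval_le hν hp
        have : 0 ≤ ε / (μ.real univ + ν.real univ + 1) := by positivity
        linarith
    _ = ε := div_mul_cancel₀ _ mass_pos.ne'

/-- The substitution `y = exp (-c x)` carries `[0, ∞)` into `[0, 1]`, and the Laplace transform at
`k c` to the `k`-th moment. -/
lemma ext_of_laplace_eq {μ ν : Measure ℝ} [IsFiniteMeasure μ] [IsFiniteMeasure ν]
    (hμ : ∀ᵐ x ∂μ, 0 ≤ x) (hν : ∀ᵐ x ∂ν, 0 ≤ x) {c : ℝ} (hc : 0 < c)
    (h : ∀ k : ℕ, laplace μ (k * c) = laplace ν (k * c)) : μ = ν := by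
  have embedding : MeasurableEmbedding fun x : ℝ => Real.exp (-(c * x)) :=
    Continuous.measurableEmbedding (by fun_prop) fun x y hxy => by
      simpa [hc.ne'] using Real.exp_injective hxy
  have ae_mem_Icc {ρ : Measure ℝ} (hρ : ∀ᵐ x ∂ρ, 0 ≤ x) :
      ∀ᵐ y ∂ρ.map fun x => Real.exp (-(c * x)), y ∈ Icc (0 : ℝ) 1 := by
    rw [embedding.ae_map_iff]
    filter_upwards [hρ] with x hx
    exact ⟨(Real.exp_pos _).le, Real.exp_le_one_iff.mpr (by nlinarith)⟩
  have integral_pow (ρ : Measure ℝ) (k : ℕ) :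
      ∫ y, y ^ k ∂ρ.map (fun x => Real.exp (-(c * x))) = (laplace ρ (k * c)).toReal := by
    rw [embedding.integral_map, integral_eq_lintegral_of_nonneg_ae
      (ae_of_all _ fun x => by positivity) (by fun_prop), laplace]
    simp only [← Real.exp_nat_mul, mul_neg, mul_assoc]
  exact embedding.map_injective (ext_of_integral_pow_eq (ae_mem_Icc hμ) (ae_mem_Icc hν)
    fun k => by rw [integral_pow, integral_pow, h])

/-- The `k`-th moment of the positive part, with values in `[0, ∞]`. -/
def posMoment (μ : Measure ℝ) (k : ℕ) : ℝ≥0∞ := ∫⁻ x, ENNReal.ofReal x ^ k ∂μ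

lemma posMoment_zero (μ : Measure ℝ) : posMoment μ 0 = μ univ := by simp [posMoment]

lemma posMoment_one (μ : Measure ℝ) : posMoment μ 1 = ∫⁻ x, ENNReal.ofReal x ∂μ := by
  simp [posMoment]

lemma posMoment_add (μ ν : Measure ℝ) (k : ℕ) :
    posMoment (μ + ν) k = posMoment μ k + posMoment ν k := lintegral_add_measure _ _ _

lemma posMoment_smul (c : ℝ≥0∞) (μ : Measure ℝ) (k : ℕ) :
    posMoment (c • μ) k = c * posMoment μ k := lintegral_smul_measure _ _

lemma posMoment_lt_top_of_le {μ : Measure ℝ} [IsFiniteMeasure μ] {i k : ℕ} (hik : i ≤ k)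
    (h : posMoment μ k < ∞) : posMoment μ i < ∞ := by
  have pow_le (x : ℝ) : ENNReal.ofReal x ^ i ≤ 1 + ENNReal.ofReal x ^ k := by
    rcases le_total (ENNReal.ofReal x) 1 with hx | hx
    · exact (pow_le_one₀ zero_le hx).trans le_self_add
    · exact (pow_le_pow_right₀ hx hik).trans le_add_self
  calc posMoment μ i ≤ ∫⁻ x, 1 + ENNReal.ofReal x ^ k ∂μ := lintegral_mono pow_le
    _ = μ univ + posMoment μ k := by
        rw [lintegral_add_left measurable_const, lintegral_one, posMoment]
    _ < ∞ := ENNReal.add_lt_top.mpr ⟨measure_lt_top μ univ, h⟩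

lemma posMoment_lt_top_of_ae_le {μ : Measure ℝ} [IsFiniteMeasure μ] {B : ℝ}
    (h : ∀ᵐ x ∂μ, x ≤ B) (k : ℕ) : posMoment μ k < ∞ := by
  calc posMoment μ k ≤ ∫⁻ _, ENNReal.ofReal B ^ k ∂μ := by
        refine lintegral_mono_ae ?_
        filter_upwards [h] with x hx
        gcongr
    _ = ENNReal.ofReal B ^ k * μ univ := lintegral_const _
    _ < ∞ := ENNReal.mul_lt_top (ENNReal.pow_lt_top ENNReal.ofReal_lt_top) (measure_lt_top μ univ)

lemma ae_nonneg_conv {μ ν : Measure ℝ} (hμ : ∀ᵐ x ∂μ, 0 ≤ x) (hν : ∀ᵐ x ∂ν, 0 ≤ x) :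
    ∀ᵐ x ∂(μ.conv ν), 0 ≤ x := by
  rw [Measure.conv, ae_map_iff (by fun_prop) measurableSet_Ici]
  filter_upwards [Measure.quasiMeasurePreserving_fst.ae hμ,
    Measure.quasiMeasurePreserving_snd.ae hν] with p h1 h2 using add_nonneg h1 h2

lemma posMoment_conv {μ ν : Measure ℝ} [SFinite ν] (hμ : ∀ᵐ x ∂μ, 0 ≤ x)
    (hν : ∀ᵐ x ∂ν, 0 ≤ x) (k : ℕ) :
    posMoment (μ.conv ν) k =
      ∑ m ∈ Finset.range (k + 1), posMoment μ m * posMoment ν (k - m) * k.choose m := by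
  have inner : ∀ᵐ x ∂μ, ∫⁻ y, ENNReal.ofReal (x + y) ^ k ∂ν =
      ∑ m ∈ Finset.range (k + 1), ENNReal.ofReal x ^ m * (posMoment ν (k - m) * k.choose m) := by
    filter_upwards [hμ] with x hx
    have binomial : ∀ᵐ y ∂ν, ENNReal.ofReal (x + y) ^ k = ∑ m ∈ Finset.range (k + 1),
        ENNReal.ofReal x ^ m * (ENNReal.ofReal y ^ (k - m) * k.choose m) := by
      filter_upwards [hν] with y hy
      simp only [ENNReal.ofReal_add hx hy, add_pow, mul_assoc]
    rw [lintegral_congr_ae binomial, lintegral_finsetSum _ fun m _ => by fun_prop]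
    refine Finset.sum_congr rfl fun m _ => ?_
    rw [lintegral_const_mul _ (by fun_prop), lintegral_mul_const _ (by fun_prop), posMoment]
  rw [posMoment, Measure.lintegral_conv (by fun_prop), lintegral_congr_ae inner,
    lintegral_finsetSum _ fun m _ => by fun_prop]
  refine Finset.sum_congr rfl fun m _ => ?_
  rw [lintegral_mul_const _ (by fun_prop), ← mul_assoc]
  rfl

lemma posMoment_conv_lt_top {μ ν : Measure ℝ} [IsFiniteMeasure μ] [IsFiniteMeasure ν]
    (hμ : ∀ᵐ x ∂μ, 0 ≤ x) (hν : ∀ᵐ x ∂ν, 0 ≤ x) {k : ℕ}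
    (hμk : posMoment μ k < ∞) (hνk : posMoment ν k < ∞) : posMoment (μ.conv ν) k < ∞ := by
  rw [posMoment_conv hμ hν]
  refine ENNReal.sum_lt_top.mpr fun m hm => ?_
  exact ENNReal.mul_lt_top (ENNReal.mul_lt_top
    (posMoment_lt_top_of_le (Finset.mem_range_succ_iff.mp hm) hμk)
    (posMoment_lt_top_of_le (Nat.sub_le k m) hνk)) (ENNReal.natCast_lt_top _)

lemma evariance_id_lt_top_iff {μ : Measure ℝ} [IsFiniteMeasure μ] (hμ : ∀ᵐ x ∂μ, 0 ≤ x) :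
    evariance (fun x : ℝ => x) μ < ∞ ↔ posMoment μ 2 < ∞ := by
  have measurable_id : AEStronglyMeasurable (fun x : ℝ => x) μ := by fun_prop
  rw [evariance_lt_top_iff_memLp measurable_id, memLp_two_iff_integrable_sq measurable_id,
    Integrable, and_iff_right (by fun_prop),
    hasFiniteIntegral_iff_ofReal (ae_of_all _ fun x => sq_nonneg x), posMoment, lintegral_congr_ae]
  filter_upwards [hμ] with x hx using ENNReal.ofReal_pow hx 2

/-- The (unnormalised) equilibrium measure of `μ`, the integrated tail of renewal theory: the
measure on `(0, ∞)` with density `t ↦ μ (t, ∞)`. -/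
def equilibrium (μ : Measure ℝ) : Measure ℝ :=
  (volume.restrict (Ioi 0)).withDensity fun t => μ (Ioi t)

instance (μ : Measure ℝ) : SFinite (equilibrium μ) := by
  unfold equilibrium
  infer_instance

lemma ae_nonneg_equilibrium (μ : Measure ℝ) : ∀ᵐ x ∂equilibrium μ, 0 ≤ x :=
  (withDensity_absolutelyContinuous _ _).ae_le
    ((ae_restrict_mem measurableSet_Ioi).mono fun _ hx => le_of_lt hx)

lemma lintegral_equilibrium {μ : Measure ℝ} (hμ : ∀ᵐ x ∂μ, 0 ≤ x) {g : ℝ → ℝ}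
    (hg : Continuous g) (hg0 : ∀ t, 0 < t → 0 ≤ g t) :
    ∫⁻ t, ENNReal.ofReal (g t) ∂equilibrium μ = ∫⁻ x, ENNReal.ofReal (∫ t in 0..x, g t) ∂μ := by
  have tail_measurable : Measurable fun t => μ (Ioi t) :=
    Antitone.measurable fun s t hst => measure_mono (Ioi_subset_Ioi hst)
  rw [equilibrium, lintegral_withDensity_eq_lintegral_mul _ tail_measurable (by fun_prop)]
  exact (lintegral_comp_eq_lintegral_meas_lt_mul μ hμ aemeasurable_id
    (fun t _ => hg.intervalIntegrable 0 t)
    ((ae_restrict_mem measurableSet_Ioi).mono hg0)).symm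

lemma posMoment_equilibrium {μ : Measure ℝ} (hμ : ∀ᵐ x ∂μ, 0 ≤ x) (k : ℕ) :
    posMoment (equilibrium μ) k = posMoment μ (k + 1) / (k + 1) := by
  calc posMoment (equilibrium μ) k = ∫⁻ t, ENNReal.ofReal (t ^ k) ∂equilibrium μ :=
        lintegral_congr_ae ((ae_nonneg_equilibrium μ).mono fun t ht =>
          (ENNReal.ofReal_pow ht k).symm)
    _ = ∫⁻ x, ENNReal.ofReal (∫ t in 0..x, t ^ k) ∂μ :=
        lintegral_equilibrium hμ (by fun_prop) fun t ht => by positivity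
    _ = ∫⁻ x, ENNReal.ofReal x ^ (k + 1) * (k + 1 : ℝ≥0∞)⁻¹ ∂μ := by
        refine lintegral_congr_ae (hμ.mono fun x hx => ?_)
        have cast_eq : ENNReal.ofReal (k + 1) = k + 1 := by
          rw [ENNReal.ofReal_add (by positivity) zero_le_one]
          simp
        simp only [integral_pow, zero_pow k.succ_ne_zero, sub_zero]
        rw [ENNReal.ofReal_div_of_pos (by positivity), ENNReal.ofReal_pow hx, cast_eq,
          ENNReal.div_eq_inv_mul, mul_comm]
    _ = posMoment μ (k + 1) / (k + 1) := lintegral_mul_const _ (by fun_prop)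

lemma equilibrium_univ {μ : Measure ℝ} (hμ : ∀ᵐ x ∂μ, 0 ≤ x) :
    equilibrium μ univ = posMoment μ 1 := by
  simpa [posMoment_zero] using posMoment_equilibrium hμ 0

lemma posMoment_equilibrium_lt_top_iff {μ : Measure ℝ} (hμ : ∀ᵐ x ∂μ, 0 ≤ x) (k : ℕ) :
    posMoment (equilibrium μ) k < ∞ ↔ posMoment μ (k + 1) < ∞ := by
  have succ_ne_top : (k + 1 : ℝ≥0∞) ≠ ∞ := by finiteness
  simp [posMoment_equilibrium hμ, lt_top_iff_ne_top, ENNReal.div_eq_top, succ_ne_top]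

lemma mul_integral_exp_neg (c x : ℝ) :
    c * ∫ t in 0..x, Real.exp (-(c * t)) = 1 - Real.exp (-(c * x)) := by
  rw [intervalIntegral.mul_integral_comp_mul_left (f := fun u => Real.exp (-u)),
    intervalIntegral.integral_comp_neg, integral_exp]
  simp

lemma laplace_add_mul_laplace_equilibrium {μ : Measure ℝ} (hμ : ∀ᵐ x ∂μ, 0 ≤ x) {s : ℝ}
    (hs : 0 < s) : laplace μ s + ENNReal.ofReal s * laplace (equilibrium μ) s = μ univ := by
  rw [laplace, laplace, lintegral_equilibrium hμ (by fun_prop) fun t _ => (Real.exp_pos _).le,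
    ← lintegral_const_mul' _ _ ENNReal.ofReal_ne_top, ← lintegral_add_left (by fun_prop),
    ← lintegral_one]
  refine lintegral_congr_ae (hμ.mono fun x hx => ?_)
  have exp_le_one : Real.exp (-(s * x)) ≤ 1 := Real.exp_le_one_iff.mpr (by nlinarith)
  beta_reduce
  rw [← ENNReal.ofReal_mul hs.le, mul_integral_exp_neg, ← ENNReal.ofReal_add (Real.exp_pos _).le
    (sub_nonneg.mpr exp_le_one), add_sub_cancel, ENNReal.ofReal_one]

lemma laplace_equilibrium_ne_top {μ : Measure ℝ} [IsFiniteMeasure μ] (hμ : ∀ᵐ x ∂μ, 0 ≤ x)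
    {s : ℝ} (hs : 0 < s) : laplace (equilibrium μ) s ≠ ∞ := by
  have product_ne_top : ENNReal.ofReal s * laplace (equilibrium μ) s ≠ ∞ :=
    ne_top_of_le_ne_top (measure_ne_top μ univ)
      (le_add_self.trans (laplace_add_mul_laplace_equilibrium hμ hs).le)
  exact (ENNReal.lt_top_of_mul_ne_top_right product_ne_top (ENNReal.ofReal_pos.mpr hs).ne').ne

lemma tsum_lt_top_of_le_mul_add {q : ℝ≥0∞} (hq : q < 1) {a b : ℕ → ℝ≥0∞} (h0 : a 0 < ∞)
    (hb : ∑' n, b n < ∞) (h : ∀ n, a (n + 1) ≤ q * a n + b n) : ∑' n, a n < ∞ := by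
  set K := a 0 + ∑' n, b n
  have hq' : 1 - q ≠ 0 := (tsub_pos_of_lt hq).ne'
  have hqt : 1 - q ≠ ∞ := ne_top_of_le_ne_top ENNReal.one_ne_top tsub_le_self
  suffices ∀ n, ∑ i ∈ Finset.range n, a i ≤ K / (1 - q) from
    (ENNReal.tsum_le_of_sum_range_le this).trans_lt
      (ENNReal.div_lt_top (ENNReal.add_lt_top.mpr ⟨h0, hb⟩).ne hq')
  intro n
  induction n with
  | zero => simp
  | succ n ih =>
    calc ∑ k ∈ Finset.range (n + 1), a k = ∑ k ∈ Finset.range n, a (k + 1) + a 0 :=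
          Finset.sum_range_succ' _ _
      _ ≤ ∑ k ∈ Finset.range n, (q * a k + b k) + a 0 := by gcongr; exact h _
      _ = q * ∑ k ∈ Finset.range n, a k + (a 0 + ∑ k ∈ Finset.range n, b k) := by
          rw [Finset.sum_add_distrib, Finset.mul_sum, add_assoc, add_comm (a 0)]
      _ ≤ q * (K / (1 - q)) + K := by
          gcongr
          exact add_le_add_right (ENNReal.sum_le_tsum _) _
      _ = q * (K / (1 - q)) + (1 - q) * (K / (1 - q)) := by
          rw [ENNReal.mul_div_cancel hq' hqt]
      _ = K / (1 - q) := by rw [← add_mul, add_tsub_cancel_of_le hq.le, one_mul]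

lemma eq_mul_add_iff_eq_div {q b x : ℝ≥0∞} (hq : q < 1) (hx : x ≠ ∞) :
    x = q * x + b ↔ x = b / (1 - q) := by
  have qx_ne_top : q * x ≠ ∞ := ENNReal.mul_ne_top hq.ne_top hx
  have sub_mul_eq : (1 - q) * x = x - q * x := by
    rw [ENNReal.sub_mul fun _ _ => hx, one_mul]
  have le_x : q * x ≤ x := mul_le_of_le_one_left' hq.le
  rw [ENNReal.eq_div_iff (tsub_pos_of_lt hq).ne' (ENNReal.sub_ne_top ENNReal.one_ne_top),
    sub_mul_eq, add_comm, eq_comm]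
  exact ⟨fun h => (ENNReal.eq_sub_of_add_eq qx_ne_top h).symm,
    fun h => h ▸ tsub_add_cancel_of_le le_x⟩

/-- The `n`-fold convolution of `κ` with the starting measure `σ`. -/
def renewalSeries (κ σ : Measure ℝ) : ℕ → Measure ℝ
  | 0 => σ
  | n + 1 => κ.conv (renewalSeries κ σ n)

/-- The solution `∑ₙ κ ^ n * σ` (powers and products being convolutions) of the renewal equation
`μ = κ * μ + σ`. -/
def renewalMeasure (κ σ : Measure ℝ) : Measure ℝ := Measure.sum (renewalSeries κ σ)

lemma posMoment_renewalMeasure (κ σ : Measure ℝ) (k : ℕ) :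
    posMoment (renewalMeasure κ σ) k = ∑' n, posMoment (renewalSeries κ σ n) k :=
  lintegral_sum_measure _ _

lemma ae_nonneg_renewalSeries {κ σ : Measure ℝ} (hκ : ∀ᵐ x ∂κ, 0 ≤ x) (hσ : ∀ᵐ x ∂σ, 0 ≤ x)
    (n : ℕ) : ∀ᵐ x ∂renewalSeries κ σ n, 0 ≤ x := by
  induction n with
  | zero => exact hσ
  | succ n ih => exact ae_nonneg_conv hκ ih

lemma ae_nonneg_renewalMeasure {κ σ : Measure ℝ} (hκ : ∀ᵐ x ∂κ, 0 ≤ x) (hσ : ∀ᵐ x ∂σ, 0 ≤ x) :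
    ∀ᵐ x ∂renewalMeasure κ σ, 0 ≤ x :=
  Measure.ae_sum_iff.mpr (ae_nonneg_renewalSeries hκ hσ)

section Renewal

variable {κ σ : Measure ℝ} [SFinite κ] [SFinite σ]

instance sFinite_renewalSeries (n : ℕ) : SFinite (renewalSeries κ σ n) := by
  induction n with
  | zero => assumption
  | succ n ih => rw [renewalSeries]; infer_instance

lemma laplace_renewalSeries (s : ℝ) (n : ℕ) :
    laplace (renewalSeries κ σ n) s = laplace κ s ^ n * laplace σ s := by
  induction n with
  | zero => rw [renewalSeries, pow_zero, one_mul]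
  | succ n ih => rw [renewalSeries, laplace_conv, ih, pow_succ', mul_assoc]

lemma laplace_renewalMeasure (s : ℝ) :
    laplace (renewalMeasure κ σ) s = laplace σ s / (1 - laplace κ s) := by
  have sum_laplace : laplace (renewalMeasure κ σ) s = ∑' n, laplace (renewalSeries κ σ n) s :=
    lintegral_sum_measure _ _
  simp only [sum_laplace, laplace_renewalSeries]
  rw [ENNReal.tsum_mul_right, ENNReal.tsum_geometric, mul_comm, ENNReal.div_eq_inv_mul, mul_comm]

lemma posMoment_renewalSeries_succ (hκ : ∀ᵐ x ∂κ, 0 ≤ x) (hσ : ∀ᵐ x ∂σ, 0 ≤ x) (k n : ℕ) :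
    posMoment (renewalSeries κ σ (n + 1)) k = κ univ * posMoment (renewalSeries κ σ n) k +
      ∑ m ∈ Finset.range k, posMoment κ (m + 1) * posMoment (renewalSeries κ σ n) (k - (m + 1)) *
        k.choose (m + 1) := by
  rw [renewalSeries, posMoment_conv hκ (ae_nonneg_renewalSeries hκ hσ n), Finset.sum_range_succ',
    add_comm]
  simp [posMoment_zero]

end Renewal

lemma posMoment_lt_top_of_renewalMeasure {κ σ : Measure ℝ} [SFinite σ] [NeZero σ]
    (hκ : ∀ᵐ x ∂κ, 0 ≤ x) (hσ : ∀ᵐ x ∂σ, 0 ≤ x) {k : ℕ} (h : posMoment (renewalMeasure κ σ) k < ∞) :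
    posMoment κ k < ∞ := by
  have le_conv : posMoment κ k * σ univ ≤ posMoment (κ.conv σ) k := by
    rw [posMoment_conv hκ hσ]
    have := Finset.single_le_sum (s := Finset.range (k + 1))
      (f := fun m => posMoment κ m * posMoment σ (k - m) * k.choose m) (fun _ _ => zero_le)
      (Finset.self_mem_range_succ k)
    simpa [posMoment_zero] using this
  have le_sum : posMoment (κ.conv σ) k ≤ posMoment (renewalMeasure κ σ) k := by
    rw [posMoment_renewalMeasure]
    exact ENNReal.le_tsum 1
  exact ENNReal.lt_top_of_mul_ne_top_left ((le_conv.trans le_sum).trans_lt h).ne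
    (Measure.measure_univ_ne_zero.mpr (NeZero.ne σ))

lemma posMoment_renewalMeasure_lt_top {κ σ : Measure ℝ} [IsFiniteMeasure σ] (hκ : ∀ᵐ x ∂κ, 0 ≤ x)
    (hσ : ∀ᵐ x ∂σ, 0 ≤ x) (hκ1 : κ univ < 1) {k : ℕ} (hκk : posMoment κ k < ∞)
    (hσk : posMoment σ k < ∞) :
    posMoment (renewalMeasure κ σ) k < ∞ := by
  have : IsFiniteMeasure κ := ⟨hκ1.trans ENNReal.one_lt_top⟩
  induction k using Nat.strong_induction_on with
  | _ k ih =>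
    rw [posMoment_renewalMeasure]
    refine tsum_lt_top_of_le_mul_add hκ1 hσk ?_ fun n =>
      (posMoment_renewalSeries_succ hκ hσ k n).le
    rw [Summable.tsum_finsetSum fun _ _ => ENNReal.summable]
    refine ENNReal.sum_lt_top.mpr fun m hm => ?_
    have hmk : m + 1 ≤ k := Finset.mem_range.mp hm
    simp only [ENNReal.tsum_mul_right, ENNReal.tsum_mul_left, ← posMoment_renewalMeasure]
    have lower_moment := ih (k - (m + 1)) (by omega)
      (posMoment_lt_top_of_le (Nat.sub_le _ _) hκk) (posMoment_lt_top_of_le (Nat.sub_le _ _) hσk)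
    exact ENNReal.mul_lt_top (ENNReal.mul_lt_top (posMoment_lt_top_of_le hmk hκk) lower_moment)
      (ENNReal.natCast_lt_top _)

lemma measurable_nat_sInf {α : Type*} [MeasurableSpace α] {p : ℕ → α → Prop}
    (hp : ∀ n, MeasurableSet {a | p n a}) : Measurable fun a => sInf {n | p n a} := by
  refine measurable_of_Iic fun n => ?_
  have preimage_eq : (fun a => sInf {n | p n a}) ⁻¹' Iic n =
      (⋃ m ∈ Iic n, {a | p m a}) ∪ ⋂ m, {a | p m a}ᶜ := by
    ext a
    simp only [mem_preimage, mem_Iic, mem_union, mem_iUnion, mem_iInter, mem_compl_iff,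
      mem_ofPred_eq, exists_prop]
    constructor
    · intro h
      by_cases hne : {n | p n a}.Nonempty
      · exact Or.inl ⟨_, h, Nat.sInf_mem hne⟩
      · exact Or.inr fun m hm => hne ⟨m, hm⟩
    · rintro (⟨m, hmn, hm⟩ | h)
      · exact (Nat.sInf_le hm).trans hmn
      · simp [h]
  rw [preimage_eq]
  exact (MeasurableSet.biUnion (to_countable _) fun m _ => hp m).union
    (MeasurableSet.iInter fun m => (hp m).compl)

lemma measurable_sum_range {α : Type*} [MeasurableSpace α] {n : α → ℕ} {f : ℕ → α → ℝ}
    (hn : Measurable n) (hf : ∀ k, Measurable (f k)) :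
    Measurable fun a => ∑ k ∈ Finset.range (n a), f k a := by
  have uncurried : Measurable fun q : ℕ × α => ∑ k ∈ Finset.range q.1, f k q.2 :=
    measurable_from_prod_countable_right fun n =>
      Finset.measurable_sum (Finset.range n) fun k _ => hf k
  exact uncurried.comp (hn.prodMk measurable_id)

@[fun_prop]
lemma measurable_vacationEnd {α : Type*} [MeasurableSpace α] {v : α → ℕ → ℝ} {u : α → ℝ}
    (hv : Measurable v) (hu : Measurable u) : Measurable fun a => vacationEnd (v a) (u a) := by
  refine measurable_sum_range (measurable_nat_sInf fun n => ?_) fun k => by fun_prop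
  exact measurableSet_le (by fun_prop) (by fun_prop)

lemma le_vacationEnd {v : ℕ → ℝ} {u : ℝ} (h : ∃ n, u ≤ ∑ k ∈ Finset.range n, v k) :
    u ≤ vacationEnd v u := Nat.sInf_mem (s := {n | u ≤ ∑ k ∈ Finset.range n, v k}) h

lemma vacationEnd_sub_le {v : ℕ → ℝ} {B u : ℝ} (hB : 0 ≤ B) (hv : ∀ k, v k ≤ B) (hu : 0 ≤ u) :
    vacationEnd v u - u ≤ B := by
  rw [vacationEnd]
  rcases h : sInf {n : ℕ | u ≤ ∑ k ∈ Finset.range n, v k} with _ | m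
  · rw [Finset.sum_range_zero]
    linarith
  · have lt_sInf : m < sInf {n : ℕ | u ≤ ∑ k ∈ Finset.range n, v k} := by omega
    have previous_end_lt : ∑ k ∈ Finset.range m, v k < u :=
      not_le.mp (Nat.notMem_of_lt_sInf lt_sInf)
    rw [Finset.sum_range_succ]
    linarith [hv m]

/-- The law of the remaining vacation time at the arrival of the first packet to an empty queue. -/
def residualLaw (lam : ℝ) (V : Measure (ℕ → ℝ)) : Measure ℝ :=
  ((expMeasure lam).prod V).map fun p => vacationEnd p.2 p.1 - p.1

/-- The wait, from arrival to start of service, of a packet as in `nextDelay`. -/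
def wait (d t : ℝ) (v : ℕ → ℝ) : ℝ := if t ≤ d then d - t else vacationEnd v (t - d) - (t - d)

lemma nextDelay_eq_add_wait (d t x : ℝ) (v : ℕ → ℝ) : nextDelay d t x v = x + wait d t v := by
  unfold nextDelay wait
  split_ifs <;> ring

@[fun_prop]
lemma measurable_wait {α : Type*} [MeasurableSpace α] {d t : α → ℝ} {v : α → ℕ → ℝ}
    (hd : Measurable d) (ht : Measurable t) (hv : Measurable v) :
    Measurable fun a => wait (d a) (t a) (v a) :=
  Measurable.ite (measurableSet_le ht hd) (by fun_prop) (by fun_prop)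

lemma setLIntegral_expMeasure (lam : ℝ) {s : Set ℝ} (hs : MeasurableSet s) {f : ℝ → ℝ≥0∞}
    (hf : Measurable f) : ∫⁻ t in s, f t ∂expMeasure lam =
      ∫⁻ t in s ∩ Ioi 0, ENNReal.ofReal (lam * Real.exp (-(lam * t))) * f t := by
  have measurable_pdf : Measurable (exponentialPDF lam) :=
    (measurable_exponentialPDFReal lam).ennreal_ofReal
  change ∫⁻ t in s, f t ∂volume.withDensity (exponentialPDF lam) = _
  rw [setLIntegral_withDensity_eq_setLIntegral_mul _ measurable_pdf hf hs,
    ← lintegral_indicator hs, ← lintegral_indicator (hs.inter measurableSet_Ioi)]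
  refine lintegral_congr_ae ?_
  filter_upwards [Measure.ae_ne volume 0] with t ht
  rcases lt_or_gt_of_ne ht with h | h
  · by_cases hts : t ∈ s <;> simp [hts, h.le, exponentialPDF_of_neg h]
  · by_cases hts : t ∈ s <;> simp [hts, h, exponentialPDF_of_nonneg h.le]

lemma lintegral_expMeasure (lam : ℝ) {f : ℝ → ℝ≥0∞} (hf : Measurable f) :
    ∫⁻ t, f t ∂expMeasure lam =
      ∫⁻ t in Ioi 0, ENNReal.ofReal (lam * Real.exp (-(lam * t))) * f t := by
  simpa using setLIntegral_expMeasure lam MeasurableSet.univ hf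

lemma ae_pos_expMeasure (lam : ℝ) : ∀ᵐ t ∂expMeasure lam, 0 < t := by
  have null : ∫⁻ _ in Iic 0, 1 ∂expMeasure lam = 0 := by
    rw [setLIntegral_expMeasure lam measurableSet_Iic measurable_const, Iic_inter_Ioi, Ioc_self,
      Measure.restrict_empty, lintegral_zero_measure]
  rw [ae_iff]
  simpa [Iic] using null

/-- The memoryless property: past `d`, an exponential time starts afresh. -/
lemma setLIntegral_Ioi_expMeasure {lam d : ℝ} (hd : 0 ≤ d) {g : ℝ → ℝ≥0∞} (hg : Measurable g) :
    ∫⁻ t in Ioi d, g (t - d) ∂expMeasure lam =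
      ENNReal.ofReal (Real.exp (-(lam * d))) * ∫⁻ t, g t ∂expMeasure lam := by
  rw [setLIntegral_expMeasure lam measurableSet_Ioi (by fun_prop), lintegral_expMeasure lam hg,
    inter_eq_left.mpr (Ioi_subset_Ioi hd), ← (measurePreserving_add_right volume d
      ).setLIntegral_comp_preimage measurableSet_Ioi (by fun_prop), preimage_add_const_Ioi,
    sub_self, ← lintegral_const_mul _ (by fun_prop)]
  refine lintegral_congr fun t => ?_
  rw [add_sub_cancel_right, ← mul_assoc, ← ENNReal.ofReal_mul (Real.exp_pos _).le, mul_left_comm,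
    ← Real.exp_add]
  congr 4
  ring

/-- The contribution `E[exp (-s (d - T)); T ≤ d]` of a packet that finds the queue non-empty to
the Laplace transform of its wait, when it arrives an exponential time `T` after its predecessor,
whose delay is `d`. -/
def busyLaplace (lam s d : ℝ) : ℝ≥0∞ :=
  ∫⁻ t in Iic d, ENNReal.ofReal (Real.exp (-(s * (d - t)))) ∂expMeasure lam

lemma measurable_busyLaplace {lam : ℝ} (hl : 0 < lam) (s : ℝ) : Measurable (busyLaplace lam s) := by
  have := isProbabilityMeasure_expMeasure hl
  have eq_lintegral_indicator : busyLaplace lam s = fun d => ∫⁻ t, {p : ℝ × ℝ | p.2 ≤ p.1}.indicator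
      (fun p => ENNReal.ofReal (Real.exp (-(s * (p.1 - p.2))))) (d, t) ∂expMeasure lam :=
    funext fun d => (lintegral_indicator measurableSet_Iic _).symm
  rw [eq_lintegral_indicator]
  exact (Measurable.indicator (by fun_prop)
    (measurableSet_le measurable_snd measurable_fst)).lintegral_prod_right'

lemma busyLaplace_le_one {lam s : ℝ} (hl : 0 < lam) (hs : 0 ≤ s) (d : ℝ) :
    busyLaplace lam s d ≤ 1 := by
  have := isProbabilityMeasure_expMeasure hl
  calc busyLaplace lam s d ≤ ∫⁻ _ in Iic d, 1 ∂expMeasure lam := by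
        refine setLIntegral_mono measurable_const fun t ht => ?_
        rw [ENNReal.ofReal_le_one, Real.exp_le_one_iff, neg_nonpos]
        exact mul_nonneg hs (sub_nonneg.mpr ht)
    _ ≤ 1 := by simpa using prob_le_one

lemma sub_mul_integral_exp_mul_exp (lam s d : ℝ) :
    (lam - s) * ∫ t in 0..d, Real.exp (-(lam * t)) * Real.exp (-(s * (d - t))) =
      Real.exp (-(s * d)) - Real.exp (-(lam * d)) := by
  have factor (t : ℝ) : Real.exp (-(lam * t)) * Real.exp (-(s * (d - t))) =
      Real.exp (-(s * d)) * Real.exp (-((lam - s) * t)) := by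
    rw [← Real.exp_add, ← Real.exp_add]
    congr 1
    ring
  simp only [factor]
  rw [intervalIntegral.integral_const_mul, mul_left_comm, mul_integral_exp_neg, mul_sub, mul_one,
    ← Real.exp_add]
  congr 2
  ring

lemma mul_busyLaplace_add {lam s d : ℝ} (hl : 0 < lam) (hs : 0 ≤ s) (hd : 0 ≤ d) :
    ENNReal.ofReal lam * busyLaplace lam s d +
        ENNReal.ofReal lam * ENNReal.ofReal (Real.exp (-(lam * d))) =
      ENNReal.ofReal s * busyLaplace lam s d +
        ENNReal.ofReal lam * ENNReal.ofReal (Real.exp (-(s * d))) := by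
  set I := ∫ t in 0..d, Real.exp (-(lam * t)) * Real.exp (-(s * (d - t)))
  have I_nonneg : 0 ≤ I := intervalIntegral.integral_nonneg hd fun t _ => by positivity
  have busyLaplace_eq : busyLaplace lam s d = ENNReal.ofReal (lam * I) := by
    rw [busyLaplace, setLIntegral_expMeasure lam measurableSet_Iic (by fun_prop), Iic_inter_Ioi,
      ← intervalIntegral.integral_const_mul, intervalIntegral.integral_of_le hd,
      ofReal_integral_eq_lintegral_ofReal
        (Continuous.integrableOn_Ioc (by fun_prop)) (ae_of_all _ fun t => by positivity)]
    refine lintegral_congr fun t => ?_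
    rw [← ENNReal.ofReal_mul (by positivity), mul_assoc]
  rw [busyLaplace_eq, ← ENNReal.ofReal_mul hl.le, ← ENNReal.ofReal_mul hl.le,
    ← ENNReal.ofReal_mul hl.le, ← ENNReal.ofReal_mul hs, ← ENNReal.ofReal_add (by positivity)
      (by positivity), ← ENNReal.ofReal_add (by positivity) (by positivity)]
  congr 1
  linear_combination lam * sub_mul_integral_exp_mul_exp lam s d

lemma renewal_equation_iff {lam s : ℝ} (hs : s ≠ 0) (hsl : s ≠ lam) {A φ ψ x r ex er : ℝ}
    (hA : lam * A + lam * ψ = s * A + lam * φ) (hx : x + s * ex = 1) (hr : r + s * er = 1) :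
    x * (A + ψ * r) = φ ↔ φ = lam * ex * φ + ψ * (x * (lam * er + r)) := by
  have key : (lam - s) * (x * (A + ψ * r) - φ) =
      s * (φ - (lam * ex * φ + ψ * (x * (lam * er + r)))) := by
    linear_combination x * hA + (lam * φ) * hx + (lam * ψ * x) * hr
  rw [← sub_eq_zero, ← mul_eq_zero_iff_left (sub_ne_zero.mpr hsl.symm), key,
    mul_eq_zero_iff_left hs, sub_eq_zero]

section Queue

variable {lam : ℝ} {X : Measure ℝ} {V : Measure (ℕ → ℝ)}

instance [SFinite V] : SFinite (residualLaw lam V) := by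
  unfold residualLaw expMeasure gammaMeasure
  infer_instance

lemma isProbabilityMeasure_residualLaw (hl : 0 < lam) [IsProbabilityMeasure V] :
    IsProbabilityMeasure (residualLaw lam V) :=
  have := isProbabilityMeasure_expMeasure hl
  Measure.isProbabilityMeasure_map (by fun_prop)

lemma ae_nonneg_residualLaw (hl : 0 < lam)
    (hV : ∀ᵐ v ∂V, ∀ u, ∃ n, u ≤ ∑ k ∈ Finset.range n, v k) :
    ∀ᵐ x ∂residualLaw lam V, 0 ≤ x := by
  have := isProbabilityMeasure_expMeasure hl
  rw [residualLaw, ae_map_iff (by fun_prop) measurableSet_Ici]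
  filter_upwards [Measure.quasiMeasurePreserving_snd.ae hV] with p hp
  exact sub_nonneg.mpr (le_vacationEnd (hp _))

lemma ae_residualLaw_le (hl : 0 < lam) {B : ℝ} (hB : 0 ≤ B)
    (hV : ∀ᵐ v ∂V, ∀ k, v k ≤ B) : ∀ᵐ x ∂residualLaw lam V, x ≤ B := by
  have := isProbabilityMeasure_expMeasure hl
  rw [residualLaw, ae_map_iff (by fun_prop) measurableSet_Iic]
  filter_upwards [Measure.quasiMeasurePreserving_fst.ae (ae_pos_expMeasure lam),
    Measure.quasiMeasurePreserving_snd.ae hV] with p hp hv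
  exact vacationEnd_sub_le hB hv hp.le

lemma lintegral_exp_wait (hl : 0 < lam) [IsProbabilityMeasure V] (s : ℝ) {d : ℝ} (hd : 0 ≤ d) :
    ∫⁻ t, ∫⁻ v, ENNReal.ofReal (Real.exp (-(s * wait d t v))) ∂V ∂expMeasure lam =
      busyLaplace lam s d +
        ENNReal.ofReal (Real.exp (-(lam * d))) * laplace (residualLaw lam V) s := by
  have := isProbabilityMeasure_expMeasure hl
  have busy :
      ∫⁻ t in Iic d, ∫⁻ v, ENNReal.ofReal (Real.exp (-(s * wait d t v))) ∂V ∂expMeasure lam =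
        busyLaplace lam s d := by
    refine setLIntegral_congr_fun measurableSet_Iic fun t ht => ?_
    simp only [wait, if_pos (mem_Iic.mp ht), lintegral_const, measure_univ, mul_one]
  have idle :
      ∫⁻ t in Ioi d, ∫⁻ v, ENNReal.ofReal (Real.exp (-(s * wait d t v))) ∂V ∂expMeasure lam =
        ENNReal.ofReal (Real.exp (-(lam * d))) * laplace (residualLaw lam V) s := by
    rw [laplace, residualLaw, lintegral_map (by fun_prop) (by fun_prop),
      lintegral_prod _ (by fun_prop), ← setLIntegral_Ioi_expMeasure hd
        (Measurable.lintegral_prod_right' (f := fun p : ℝ × (ℕ → ℝ) =>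
          ENNReal.ofReal (Real.exp (-(s * (vacationEnd p.2 p.1 - p.1))))) (by fun_prop))]
    refine setLIntegral_congr_fun measurableSet_Ioi fun t ht => ?_
    simp only [wait, if_neg (not_le.mpr (mem_Ioi.mp ht))]
  rw [← lintegral_add_compl _ (measurableSet_Iic (a := d)), compl_Iic, busy, idle]

/-- The law of the delay of a packet when that of the preceding one is `μ`, for arrival rate `lam`,
service law `X` and law `V` of the sequence of vacations. -/
def nextDelayLaw (lam : ℝ) (X : Measure ℝ) (V : Measure (ℕ → ℝ)) (μ : Measure ℝ) : Measure ℝ :=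
  (μ.prod ((expMeasure lam).prod (X.prod V))).map
    fun ω => nextDelay ω.1 ω.2.1 ω.2.2.1 ω.2.2.2

@[fun_prop]
lemma measurable_nextDelay {α : Type*} [MeasurableSpace α] {d t x : α → ℝ} {v : α → ℕ → ℝ}
    (hd : Measurable d) (ht : Measurable t) (hx : Measurable x) (hv : Measurable v) :
    Measurable fun a => nextDelay (d a) (t a) (x a) (v a) := by
  simp only [nextDelay_eq_add_wait]
  fun_prop

lemma isProbabilityMeasure_nextDelayLaw (hl : 0 < lam) [IsProbabilityMeasure X]
    [IsProbabilityMeasure V] (μ : Measure ℝ) [IsProbabilityMeasure μ] :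
    IsProbabilityMeasure (nextDelayLaw lam X V μ) :=
  have := isProbabilityMeasure_expMeasure hl
  Measure.isProbabilityMeasure_map (by fun_prop)

lemma ae_nonneg_nextDelayLaw (hl : 0 < lam) (hX : ∀ᵐ x ∂X, 0 ≤ x)
    (hV : ∀ᵐ v ∂V, ∀ u, ∃ n, u ≤ ∑ k ∈ Finset.range n, v k) (μ : Measure ℝ) :
    ∀ᵐ d ∂nextDelayLaw lam X V μ, 0 ≤ d := by
  have := isProbabilityMeasure_expMeasure hl
  have ae_XV : ∀ᵐ p ∂X.prod V, 0 ≤ p.1 ∧ ∀ u, ∃ n, u ≤ ∑ k ∈ Finset.range n, p.2 k :=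
    (Measure.quasiMeasurePreserving_fst.ae hX).and (Measure.quasiMeasurePreserving_snd.ae hV)
  rw [nextDelayLaw, ae_map_iff (by fun_prop) measurableSet_Ici]
  filter_upwards [Measure.quasiMeasurePreserving_snd.ae
    (Measure.quasiMeasurePreserving_snd.ae ae_XV)] with ω hω
  rw [nextDelay_eq_add_wait, wait]
  refine add_nonneg hω.1 ?_
  split_ifs with h
  · exact sub_nonneg.mpr h
  · exact sub_nonneg.mpr (le_vacationEnd (hω.2 _))

lemma laplace_nextDelayLaw (hl : 0 < lam) [SFinite X] [IsProbabilityMeasure V] {μ : Measure ℝ}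
    (hμ : ∀ᵐ d ∂μ, 0 ≤ d) (s : ℝ) :
    laplace (nextDelayLaw lam X V μ) s = laplace X s *
      (∫⁻ d, busyLaplace lam s d ∂μ + laplace μ lam * laplace (residualLaw lam V) s) := by
  have := isProbabilityMeasure_expMeasure hl
  have exp_nextDelay (d t x : ℝ) (v : ℕ → ℝ) :
      ENNReal.ofReal (Real.exp (-(s * nextDelay d t x v))) =
        ENNReal.ofReal (Real.exp (-(s * x))) * ENNReal.ofReal (Real.exp (-(s * wait d t v))) := by
    rw [← ENNReal.ofReal_mul (Real.exp_pos _).le, ← Real.exp_add, nextDelay_eq_add_wait, mul_add,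
      neg_add]
  calc laplace (nextDelayLaw lam X V μ) s
      = ∫⁻ d, ∫⁻ t, ∫⁻ p : ℝ × (ℕ → ℝ), ENNReal.ofReal (Real.exp (-(s * p.1))) *
          ENNReal.ofReal (Real.exp (-(s * wait d t p.2))) ∂X.prod V ∂expMeasure lam ∂μ := by
        rw [laplace, nextDelayLaw, lintegral_map (by fun_prop) (by fun_prop),
          lintegral_prod _ (by fun_prop)]
        refine lintegral_congr fun d => ?_
        rw [lintegral_prod _ (by fun_prop)]
        simp only [exp_nextDelay]
    _ = ∫⁻ d, ∫⁻ t, laplace X s *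
          ∫⁻ v, ENNReal.ofReal (Real.exp (-(s * wait d t v))) ∂V ∂expMeasure lam ∂μ := by
        refine lintegral_congr fun d => lintegral_congr fun t => ?_
        exact lintegral_prod_mul (f := fun x => ENNReal.ofReal (Real.exp (-(s * x))))
          (g := fun v => ENNReal.ofReal (Real.exp (-(s * wait d t v)))) (by fun_prop) (by fun_prop)
    _ = ∫⁻ d, laplace X s * (busyLaplace lam s d +
          ENNReal.ofReal (Real.exp (-(lam * d))) * laplace (residualLaw lam V) s) ∂μ := by
        refine lintegral_congr_ae (hμ.mono fun d hd => ?_)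
        beta_reduce
        rw [lintegral_const_mul _ (Measurable.lintegral_prod_right' (f := fun p : ℝ × (ℕ → ℝ) =>
          ENNReal.ofReal (Real.exp (-(s * wait d p.1 p.2)))) (by fun_prop)),
          lintegral_exp_wait hl s hd]
    _ = laplace X s *
          (∫⁻ d, busyLaplace lam s d ∂μ + laplace μ lam * laplace (residualLaw lam V) s) := by
        have measurable_busy := measurable_busyLaplace hl s
        rw [lintegral_const_mul _ (by fun_prop), lintegral_add_left measurable_busy,
          lintegral_mul_const _ (by fun_prop)]
        rfl

lemma mul_lintegral_busyLaplace_add (hl : 0 < lam) {μ : Measure ℝ} (hμ : ∀ᵐ d ∂μ, 0 ≤ d)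
    {s : ℝ} (hs : 0 ≤ s) :
    ENNReal.ofReal lam * ∫⁻ d, busyLaplace lam s d ∂μ + ENNReal.ofReal lam * laplace μ lam =
      ENNReal.ofReal s * ∫⁻ d, busyLaplace lam s d ∂μ + ENNReal.ofReal lam * laplace μ s := by
  have measurable_busy := measurable_busyLaplace hl s
  rw [laplace, laplace, ← lintegral_const_mul _ measurable_busy,
    ← lintegral_const_mul _ (by fun_prop), ← lintegral_const_mul _ measurable_busy,
    ← lintegral_const_mul _ (by fun_prop), ← lintegral_add_left (by fun_prop),
    ← lintegral_add_left (by fun_prop)]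
  exact lintegral_congr_ae (hμ.mono fun d hd => mul_busyLaplace_add hl hs hd)

/-- The kernel of the renewal equation for the stationary delay law. Its mass is the load `ρ`. -/
def delayKernel (lam : ℝ) (X : Measure ℝ) : Measure ℝ := ENNReal.ofReal lam • equilibrium X

instance : SFinite (delayKernel lam X) := by
  unfold delayKernel
  infer_instance

lemma ae_nonneg_delayKernel : ∀ᵐ x ∂delayKernel lam X, 0 ≤ x :=
  Measure.ae_smul_measure (ae_nonneg_equilibrium X) _

lemma laplace_delayKernel (s : ℝ) :
    laplace (delayKernel lam X) s = ENNReal.ofReal lam * laplace (equilibrium X) s :=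
  laplace_smul _ _ _

lemma laplace_delayKernel_self [IsProbabilityMeasure X] (hl : 0 < lam) (hX : ∀ᵐ x ∂X, 0 ≤ x) :
    laplace (delayKernel lam X) lam = 1 - laplace X lam := by
  rw [laplace_delayKernel]
  refine ENNReal.eq_sub_of_add_eq (laplace_ne_top hX hl.le) ?_
  rw [add_comm, laplace_add_mul_laplace_equilibrium hX hl, measure_univ]

lemma delayKernel_univ (hX : ∀ᵐ x ∂X, 0 ≤ x) :
    delayKernel lam X univ = ENNReal.ofReal lam * posMoment X 1 := by
  rw [delayKernel, Measure.smul_apply, smul_eq_mul, equilibrium_univ hX]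

lemma posMoment_delayKernel_lt_top_iff (hl : 0 < lam) (hX : ∀ᵐ x ∂X, 0 ≤ x) (k : ℕ) :
    posMoment (delayKernel lam X) k < ∞ ↔ posMoment X (k + 1) < ∞ := by
  rw [delayKernel, posMoment_smul, ← posMoment_equilibrium_lt_top_iff hX k, lt_top_iff_ne_top,
    lt_top_iff_ne_top, Ne, Ne, ENNReal.mul_eq_top]
  simp [hl]

/-- Up to normalization, the law of the delay of a packet that arrives during a vacation: its
service time plus a remaining vacation time, whose law combines those seen by the packets that
arrive during a vacation as its first and as later ones. -/
def seedLaw (lam : ℝ) (X : Measure ℝ) (V : Measure (ℕ → ℝ)) : Measure ℝ :=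
  X.conv (ENNReal.ofReal lam • equilibrium (residualLaw lam V) + residualLaw lam V)

instance [SFinite X] [SFinite V] : SFinite (seedLaw lam X V) := by
  unfold seedLaw
  infer_instance

lemma laplace_seedLaw (hl : 0 < lam) [IsProbabilityMeasure V] (s : ℝ) :
    laplace (seedLaw lam X V) s = laplace X s * (ENNReal.ofReal lam *
      laplace (equilibrium (residualLaw lam V)) s + laplace (residualLaw lam V) s) := by
  have := isProbabilityMeasure_residualLaw (V := V) hl
  rw [seedLaw, laplace_conv, laplace_add, laplace_smul]

lemma laplace_seedLaw_self (hl : 0 < lam) [IsProbabilityMeasure V]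
    (hR : ∀ᵐ x ∂residualLaw lam V, 0 ≤ x) : laplace (seedLaw lam X V) lam = laplace X lam := by
  have := isProbabilityMeasure_residualLaw (V := V) hl
  rw [laplace_seedLaw hl, add_comm, laplace_add_mul_laplace_equilibrium hR hl, measure_univ,
    mul_one]

lemma ae_nonneg_seedLaw (hl : 0 < lam) [IsProbabilityMeasure V]
    (hX : ∀ᵐ x ∂X, 0 ≤ x) (hR : ∀ᵐ x ∂residualLaw lam V, 0 ≤ x) :
    ∀ᵐ x ∂seedLaw lam X V, 0 ≤ x :=
  have := isProbabilityMeasure_residualLaw (V := V) hl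
  ae_nonneg_conv hX
    (ae_add_measure_iff.mpr ⟨Measure.ae_smul_measure (ae_nonneg_equilibrium _) _, hR⟩)

lemma seedLaw_univ (hl : 0 < lam) [IsProbabilityMeasure X] [IsProbabilityMeasure V]
    (hR : ∀ᵐ x ∂residualLaw lam V, 0 ≤ x) :
    seedLaw lam X V univ = ENNReal.ofReal lam * posMoment (residualLaw lam V) 1 + 1 := by
  have := isProbabilityMeasure_residualLaw (V := V) hl
  rw [← laplace_zero, laplace_seedLaw hl, laplace_zero, laplace_zero, laplace_zero,
    equilibrium_univ hR, measure_univ, measure_univ, one_mul]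

lemma seedLaw_univ_ne_zero (hl : 0 < lam) [IsProbabilityMeasure X] [IsProbabilityMeasure V]
    (hR : ∀ᵐ x ∂residualLaw lam V, 0 ≤ x) : seedLaw lam X V univ ≠ 0 := by
  simp [seedLaw_univ hl hR]

lemma posMoment_seedLaw_lt_top (hl : 0 < lam) [IsProbabilityMeasure X] [IsProbabilityMeasure V]
    (hX : ∀ᵐ x ∂X, 0 ≤ x) (hR : ∀ᵐ x ∂residualLaw lam V, 0 ≤ x) {k : ℕ}
    (hXk : posMoment X k < ∞) (hRk : posMoment (residualLaw lam V) (k + 1) < ∞) :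
    posMoment (seedLaw lam X V) k < ∞ := by
  have := isProbabilityMeasure_residualLaw (V := V) hl
  have : IsFiniteMeasure (equilibrium (residualLaw lam V)) :=
    ⟨by rw [equilibrium_univ hR]; exact posMoment_lt_top_of_le (Nat.le_add_left 1 k) hRk⟩
  have := (equilibrium (residualLaw lam V)).smul_finite (ENNReal.ofReal_ne_top (r := lam))
  refine posMoment_conv_lt_top hX
    (ae_add_measure_iff.mpr ⟨Measure.ae_smul_measure (ae_nonneg_equilibrium _) _, hR⟩) hXk ?_
  rw [posMoment_add, posMoment_smul]
  exact ENNReal.add_lt_top.mpr ⟨ENNReal.mul_lt_top ENNReal.ofReal_lt_top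
    ((posMoment_equilibrium_lt_top_iff hR k).mpr hRk), posMoment_lt_top_of_le k.le_succ hRk⟩

lemma seedLaw_univ_ne_top (hl : 0 < lam) [IsProbabilityMeasure X] [IsProbabilityMeasure V]
    (hX : ∀ᵐ x ∂X, 0 ≤ x) (hR : ∀ᵐ x ∂residualLaw lam V, 0 ≤ x)
    (hR1 : posMoment (residualLaw lam V) 1 < ∞) : seedLaw lam X V univ ≠ ∞ := by
  rw [← posMoment_zero]
  exact (posMoment_seedLaw_lt_top hl hX hR (by simp [posMoment_zero]) hR1).ne

lemma laplace_nextDelayLaw_eq_iff (hl : 0 < lam) [IsProbabilityMeasure X] [IsProbabilityMeasure V]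
    (hX : ∀ᵐ x ∂X, 0 ≤ x) (hR : ∀ᵐ x ∂residualLaw lam V, 0 ≤ x) {μ : Measure ℝ}
    [IsProbabilityMeasure μ] (hμ : ∀ᵐ x ∂μ, 0 ≤ x) {s : ℝ} (hs : 0 < s) (hsl : s ≠ lam) :
    laplace (nextDelayLaw lam X V μ) s = laplace μ s ↔
      laplace μ s = laplace (delayKernel lam X) s * laplace μ s +
        laplace μ lam * laplace (seedLaw lam X V) s := by
  have := isProbabilityMeasure_residualLaw (V := V) hl
  rw [laplace_nextDelayLaw hl hμ, laplace_seedLaw hl, laplace_delayKernel]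
  have busy_ne_top : ∫⁻ d, busyLaplace lam s d ∂μ ≠ ∞ :=
    ((lintegral_mono fun d => busyLaplace_le_one hl hs.le d).trans_lt (by simp)).ne
  have busy_eq := mul_lintegral_busyLaplace_add hl hμ hs.le
  have X_eq := laplace_add_mul_laplace_equilibrium hX hs
  have R_eq := laplace_add_mul_laplace_equilibrium hR hs
  lift ∫⁻ d, busyLaplace lam s d ∂μ to NNReal using busy_ne_top with A
  lift laplace μ s to NNReal using laplace_ne_top hμ hs.le with φ
  lift laplace μ lam to NNReal using laplace_ne_top hμ hl.le with ψ
  lift laplace X s to NNReal using laplace_ne_top hX hs.le with x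
  lift laplace (residualLaw lam V) s to NNReal using laplace_ne_top hR hs.le with r
  lift laplace (equilibrium X) s to NNReal using laplace_equilibrium_ne_top hX hs with ex
  lift laplace (equilibrium (residualLaw lam V)) s to NNReal using
    laplace_equilibrium_ne_top hR hs with er
  simp only [ENNReal.ofReal, measure_univ] at busy_eq X_eq R_eq ⊢
  norm_cast at busy_eq X_eq R_eq ⊢
  simp only [← NNReal.coe_inj, NNReal.coe_add, NNReal.coe_mul, NNReal.coe_one,
    Real.coe_toNNReal _ hl.le, Real.coe_toNNReal _ hs.le] at busy_eq X_eq R_eq ⊢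
  exact renewal_equation_iff hs.ne' hsl busy_eq X_eq R_eq

lemma delayKernel_univ_add_eq_one (hl : 0 < lam) [IsProbabilityMeasure X] [IsProbabilityMeasure V]
    (hX : ∀ᵐ x ∂X, 0 ≤ x) (hR : ∀ᵐ x ∂residualLaw lam V, 0 ≤ x) {μ : Measure ℝ}
    [IsProbabilityMeasure μ] (hμ : ∀ᵐ x ∂μ, 0 ≤ x) (h : nextDelayLaw lam X V μ = μ) :
    delayKernel lam X univ + laplace μ lam * seedLaw lam X V univ = 1 := by
  have tendsto_laplace_μ := tendsto_laplace_measure_univ hμ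
  rw [measure_univ] at tendsto_laplace_μ
  have tendsto_rhs := (ENNReal.Tendsto.mul
    (tendsto_laplace_measure_univ (ae_nonneg_delayKernel (lam := lam) (X := X)))
    (Or.inr ENNReal.one_ne_top) tendsto_laplace_μ (Or.inl one_ne_zero)).add
      (ENNReal.Tendsto.const_mul (tendsto_laplace_measure_univ (ae_nonneg_seedLaw hl hX hR))
        (Or.inr (laplace_ne_top hμ hl.le)))
  rw [mul_one] at tendsto_rhs
  refine tendsto_nhds_unique tendsto_rhs (tendsto_laplace_μ.congr' ?_)
  filter_upwards [tendsto_one_div_add_atTop_nhds_zero_nat.eventually (gt_mem_nhds hl)] with n hn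
  exact (laplace_nextDelayLaw_eq_iff hl hX hR hμ (by positivity) hn.ne).mp (by rw [h])

/-- The law of the delay in the queue with load `ρ = delayKernel lam X univ < 1`, as given by the
Pollaczek–Khinchine geometric compound: `delayKernel` is convolved with itself a geometric number
of times, and then with the normalized `seedLaw`. -/
def delayLaw (lam : ℝ) (X : Measure ℝ) (V : Measure (ℕ → ℝ)) : Measure ℝ :=
  ((1 - delayKernel lam X univ) / seedLaw lam X V univ) •
    renewalMeasure (delayKernel lam X) (seedLaw lam X V)

lemma laplace_delayLaw [SFinite X] [SFinite V] (s : ℝ) : laplace (delayLaw lam X V) s =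
    (1 - delayKernel lam X univ) / seedLaw lam X V univ *
      (laplace (seedLaw lam X V) s / (1 - laplace (delayKernel lam X) s)) := by
  rw [delayLaw, laplace_smul, laplace_renewalMeasure]

lemma laplace_delayLaw_self (hl : 0 < lam) [IsProbabilityMeasure X] [IsProbabilityMeasure V]
    (hX : ∀ᵐ x ∂X, 0 ≤ x) (hR : ∀ᵐ x ∂residualLaw lam V, 0 ≤ x) :
    laplace (delayLaw lam X V) lam = (1 - delayKernel lam X univ) / seedLaw lam X V univ := by
  have laplace_X_le_one : laplace X lam ≤ 1 := by
    simpa using laplace_le_measure_univ hX hl.le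
  rw [laplace_delayLaw, laplace_delayKernel_self hl hX, laplace_seedLaw_self hl hR,
    ENNReal.sub_sub_cancel ENNReal.one_ne_top laplace_X_le_one,
    ENNReal.div_self (laplace_pos X lam).ne' (laplace_ne_top hX hl.le), mul_one]

lemma isProbabilityMeasure_delayLaw (hl : 0 < lam) [IsProbabilityMeasure X]
    [IsProbabilityMeasure V] (hX : ∀ᵐ x ∂X, 0 ≤ x) (hR : ∀ᵐ x ∂residualLaw lam V, 0 ≤ x)
    (hR1 : posMoment (residualLaw lam V) 1 < ∞) (hρ : delayKernel lam X univ < 1) :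
    IsProbabilityMeasure (delayLaw lam X V) := by
  constructor
  rw [← laplace_zero, laplace_delayLaw, laplace_zero, laplace_zero, ← mul_div_assoc,
    ENNReal.div_mul_cancel (seedLaw_univ_ne_zero hl hR)
      (seedLaw_univ_ne_top hl hX hR hR1),
    ENNReal.div_self (tsub_pos_of_lt hρ).ne' (ENNReal.sub_ne_top ENNReal.one_ne_top)]

lemma ae_nonneg_delayLaw (hl : 0 < lam) [IsProbabilityMeasure V]
    (hX : ∀ᵐ x ∂X, 0 ≤ x) (hR : ∀ᵐ x ∂residualLaw lam V, 0 ≤ x) :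
    ∀ᵐ x ∂delayLaw lam X V, 0 ≤ x :=
  Measure.ae_smul_measure
    (ae_nonneg_renewalMeasure ae_nonneg_delayKernel (ae_nonneg_seedLaw hl hX hR)) _

lemma nextDelayLaw_eq_self_iff (hl : 0 < lam) [IsProbabilityMeasure X] [IsProbabilityMeasure V]
    (hX : ∀ᵐ x ∂X, 0 ≤ x) (hV : ∀ᵐ v ∂V, ∀ u, ∃ n, u ≤ ∑ k ∈ Finset.range n, v k)
    {μ : Measure ℝ} [IsProbabilityMeasure μ] (hμ : ∀ᵐ x ∂μ, 0 ≤ x) :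
    nextDelayLaw lam X V μ = μ ↔ ∀ s, 0 < s → s ≠ lam →
      laplace μ s = laplace (delayKernel lam X) s * laplace μ s +
        laplace μ lam * laplace (seedLaw lam X V) s := by
  have hR := ae_nonneg_residualLaw hl hV
  have := isProbabilityMeasure_nextDelayLaw (X := X) (V := V) hl μ
  refine ⟨fun h s hs hsl => (laplace_nextDelayLaw_eq_iff hl hX hR hμ hs hsl).mp (by rw [h]),
    fun h => ext_of_laplace_eq (ae_nonneg_nextDelayLaw hl hX hV μ) hμ (c := 2 * lam)
      (by positivity) fun k => ?_⟩
  rcases k.eq_zero_or_pos with rfl | hk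
  · simp [laplace_zero]
  have one_le_k : (1 : ℝ) ≤ k := by exact_mod_cast hk
  exact (laplace_nextDelayLaw_eq_iff hl hX hR hμ (by positivity) (by nlinarith)).mpr
    (h _ (by positivity) (by nlinarith))

lemma laplace_delayKernel_lt_one (hρ : delayKernel lam X univ < 1) {s : ℝ} (hs : 0 ≤ s) :
    laplace (delayKernel lam X) s < 1 :=
  (laplace_le_measure_univ ae_nonneg_delayKernel hs).trans_lt hρ

lemma nextDelayLaw_delayLaw (hl : 0 < lam) [IsProbabilityMeasure X] [IsProbabilityMeasure V]
    (hX : ∀ᵐ x ∂X, 0 ≤ x) (hV : ∀ᵐ v ∂V, ∀ u, ∃ n, u ≤ ∑ k ∈ Finset.range n, v k)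
    (hR1 : posMoment (residualLaw lam V) 1 < ∞) (hρ : delayKernel lam X univ < 1) :
    nextDelayLaw lam X V (delayLaw lam X V) = delayLaw lam X V := by
  have hR := ae_nonneg_residualLaw hl hV
  have := isProbabilityMeasure_delayLaw hl hX hR hR1 hρ
  have nonneg := ae_nonneg_delayLaw hl hX hR
  refine (nextDelayLaw_eq_self_iff hl hX hV nonneg).mpr fun s hs _ => ?_
  rw [eq_mul_add_iff_eq_div (laplace_delayKernel_lt_one hρ hs.le) (laplace_ne_top nonneg hs.le),
    laplace_delayLaw_self hl hX hR, laplace_delayLaw, mul_div_assoc]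

lemma eq_delayLaw_of_nextDelayLaw_eq_self (hl : 0 < lam) [IsProbabilityMeasure X]
    [IsProbabilityMeasure V] (hX : ∀ᵐ x ∂X, 0 ≤ x)
    (hV : ∀ᵐ v ∂V, ∀ u, ∃ n, u ≤ ∑ k ∈ Finset.range n, v k)
    (hR1 : posMoment (residualLaw lam V) 1 < ∞) {μ : Measure ℝ} [IsProbabilityMeasure μ]
    (hμ : ∀ᵐ x ∂μ, 0 ≤ x) (h : nextDelayLaw lam X V μ = μ) :
    delayKernel lam X univ < 1 ∧ μ = delayLaw lam X V := by
  have hR := ae_nonneg_residualLaw hl hV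
  have seed_ne_zero : seedLaw lam X V univ ≠ 0 := seedLaw_univ_ne_zero hl hR
  have mass_eq := delayKernel_univ_add_eq_one hl hX hR hμ h
  have hρ : delayKernel lam X univ < 1 := by
    rw [← mass_eq]
    refine ENNReal.lt_add_right (fun hρ => ?_) (mul_ne_zero (laplace_pos μ lam).ne' seed_ne_zero)
    simp [hρ] at mass_eq
  have laplace_self : laplace μ lam = (1 - delayKernel lam X univ) / seedLaw lam X V univ := by
    rw [ENNReal.eq_div_iff seed_ne_zero (seedLaw_univ_ne_top hl hX hR hR1), mul_comm]
    exact ENNReal.eq_sub_of_add_eq hρ.ne_top ((add_comm _ _).trans mass_eq)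
  have := isProbabilityMeasure_delayLaw hl hX hR hR1 hρ
  refine ⟨hρ, ext_of_laplace_eq hμ (ae_nonneg_delayLaw hl hX hR) (c := 2 * lam) (by positivity)
    fun k => ?_⟩
  rcases k.eq_zero_or_pos with rfl | hk
  · simp [laplace_zero]
  have one_le_k : (1 : ℝ) ≤ k := by exact_mod_cast hk
  have s_pos : 0 < k * (2 * lam) := by positivity
  have renewal_eq := (nextDelayLaw_eq_self_iff hl hX hV hμ).mp h _ s_pos (by nlinarith)
  rw [eq_mul_add_iff_eq_div (laplace_delayKernel_lt_one hρ s_pos.le) (laplace_ne_top hμ s_pos.le)]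
    at renewal_eq
  rw [renewal_eq, laplace_delayLaw, laplace_self, mul_div_assoc]

lemma posMoment_delayLaw_lt_top_iff (hl : 0 < lam) [IsProbabilityMeasure X]
    [IsProbabilityMeasure V] (hX : ∀ᵐ x ∂X, 0 ≤ x) (hR : ∀ᵐ x ∂residualLaw lam V, 0 ≤ x) {k : ℕ}
    (hRk : posMoment (residualLaw lam V) (k + 1) < ∞) (hρ : delayKernel lam X univ < 1) :
    posMoment (delayLaw lam X V) k < ∞ ↔ posMoment X (k + 1) < ∞ := by
  have hR1 : posMoment (residualLaw lam V) 1 < ∞ := by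
    have := isProbabilityMeasure_residualLaw (V := V) hl
    exact posMoment_lt_top_of_le (Nat.le_add_left 1 k) hRk
  have seed_lt_top := (seedLaw_univ_ne_top hl hX hR hR1).lt_top
  have : IsFiniteMeasure (seedLaw lam X V) := ⟨seed_lt_top⟩
  have : NeZero (seedLaw lam X V) := ⟨fun h => seedLaw_univ_ne_zero (X := X) hl hR (by simp [h])⟩
  have scale_ne_zero : (1 - delayKernel lam X univ) / seedLaw lam X V univ ≠ 0 :=
    (ENNReal.div_pos (tsub_pos_of_lt hρ).ne' seed_lt_top.ne).ne'
  have nonneg_seed := ae_nonneg_seedLaw hl hX hR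
  rw [delayLaw, posMoment_smul, ← posMoment_delayKernel_lt_top_iff hl hX]
  constructor
  · intro h
    exact posMoment_lt_top_of_renewalMeasure ae_nonneg_delayKernel nonneg_seed
      (ENNReal.lt_top_of_mul_ne_top_right h.ne scale_ne_zero)
  · intro h
    have hXk : posMoment X k < ∞ := posMoment_lt_top_of_le k.le_succ
      ((posMoment_delayKernel_lt_top_iff hl hX k).mp h)
    refine ENNReal.mul_lt_top (ENNReal.div_lt_top (ENNReal.sub_ne_top ENNReal.one_ne_top)
      (seedLaw_univ_ne_zero hl hR)) ?_
    exact posMoment_renewalMeasure_lt_top ae_nonneg_delayKernel nonneg_seed hρ h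
      (posMoment_seedLaw_lt_top hl hX hR hXk hRk)

end Queue

lemma ae_infinitePi_forall {ι : Type*} [Countable ι] {Ω : ι → Type*}
    [∀ i, MeasurableSpace (Ω i)] {μ : ∀ i, Measure (Ω i)} [∀ i, IsProbabilityMeasure (μ i)]
    {p : ∀ i, Ω i → Prop} (h : ∀ i, ∀ᵐ x ∂μ i, p i x) :
    ∀ᵐ x ∂Measure.infinitePi μ, ∀ i, p i (x i) :=
  ae_all_iff.mpr fun i =>
    (measurePreserving_eval_infinitePi μ i).quasiMeasurePreserving.ae (h i)

lemma exists_le_sum_range {v : ℕ → ℝ} {a : ℝ} (ha : 0 < a) (hv : ∀ k, a ≤ v k) (u : ℝ) :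
    ∃ n, u ≤ ∑ k ∈ Finset.range n, v k := by
  obtain ⟨n, hn⟩ := Archimedean.arch u ha
  refine ⟨n, hn.trans ?_⟩
  simpa using Finset.card_nsmul_le_sum (Finset.range n) v a fun k _ => hv k

lemma half_le_uniformOn_Iio {w : ℕ} (hw : 0 < w) : 1 / 2 ≤ uniformOn (Iio w) (Ici (w / 2)) := by
  have Ico_subset : ((Finset.Ico (w / 2) w : Finset ℕ) : Set ℕ) ⊆ Ici (w / 2) := by
    simpa using Ico_subset_Ici_self
  have range_inter : Finset.range w ∩ Finset.Ico (w / 2) w = Finset.Ico (w / 2) w :=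
    Finset.inter_eq_right.mpr fun n hn => Finset.mem_range.mpr (Finset.mem_Ico.mp hn).2
  refine le_trans ?_ (measure_mono Ico_subset)
  rw [← Finset.coe_range, uniformOn_apply_finset, range_inter, Nat.card_Ico, Finset.card_range,
    ENNReal.le_div_iff_mul_le (Or.inl (by simpa using hw.ne')) (Or.inl (by simp)), one_div,
    mul_comm, ← div_eq_mul_inv]
  refine ENNReal.div_le_of_le_mul ?_
  norm_cast
  omega

lemma sum_range_pow_le {r : ℝ} (hr : 1 < r) (j : ℕ) :
    ∑ i ∈ Finset.range (j + 1), r ^ i ≤ r / (r - 1) * r ^ j := by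
  have : 0 < r - 1 := sub_pos.mpr hr
  rw [geom_sum_eq hr.ne', div_mul_eq_mul_div, ← pow_succ']
  gcongr
  linarith

lemma tsum_geometric_mul_pow_lt_top_iff {p r C : ℝ} (hp0 : 0 ≤ p) (hp1 : p < 1) (hr : 0 ≤ r)
    (hC : 0 < C) (k : ℕ) :
    ∑' j, ENNReal.ofReal (p ^ j * (1 - p)) * ENNReal.ofReal (C * r ^ j) ^ k < ∞ ↔
      p * r ^ k < 1 := by
  have : 0 < 1 - p := sub_pos.mpr hp1
  have term_eq (j : ℕ) : ENNReal.ofReal (p ^ j * (1 - p)) * ENNReal.ofReal (C * r ^ j) ^ k =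
      ENNReal.ofReal ((1 - p) * C ^ k) * ENNReal.ofReal (p * r ^ k) ^ j := by
    rw [← ENNReal.ofReal_pow (by positivity), ← ENNReal.ofReal_pow (by positivity),
      ← ENNReal.ofReal_mul (by positivity), ← ENNReal.ofReal_mul (by positivity)]
    congr 1
    ring
  have const_ne_zero : ENNReal.ofReal ((1 - p) * C ^ k) ≠ 0 :=
    (ENNReal.ofReal_pos.mpr (by positivity)).ne'
  simp only [term_eq]
  rw [ENNReal.tsum_mul_left, ENNReal.tsum_geometric, lt_top_iff_ne_top, Ne, ENNReal.mul_eq_top]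
  simp [const_ne_zero, tsub_eq_zero_iff_le]

namespace Network

variable (S : Network)

lemma measurable_accessDelay :
    Measurable fun ω : ℕ × (ℕ → ℕ) × (ℕ → ℕ → ℝ) => S.accessDelay ω.1 ω.2.1 ω.2.2 := by
  refine ((measurable_sum_range (by fun_prop) fun i => ?_).add (by fun_prop)).add_const _
  exact measurable_sum_range (by fun_prop) fun m => by fun_prop

instance : IsProbabilityMeasure S.accessLaw :=
  Measure.isProbabilityMeasure_map S.measurable_accessDelay.aemeasurable

/-- The length of the shortest kind of slot. -/
def Tmin : ℝ := min S.Tidle (min S.Tcoll S.Tsucc)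

/-- The length of the longest kind of slot. -/
def Tmax : ℝ := max S.Tidle (max S.Tcoll S.Tsucc)

lemma Tmin_pos : 0 < S.Tmin := lt_min S.Tidle_pos (lt_min S.Tcoll_pos S.Tsucc_pos)

lemma Tmax_pos : 0 < S.Tmax := lt_max_of_lt_left S.Tidle_pos

lemma Tmin_le_Tsucc : S.Tmin ≤ S.Tsucc := (min_le_right _ _).trans (min_le_right _ _)

lemma ae_slotLaw_mem_Icc : ∀ᵐ x ∂S.slotLaw, x ∈ Icc S.Tmin S.Tmax := by
  unfold slotLaw
  rw [ae_add_measure_iff, ae_add_measure_iff]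
  refine ⟨⟨?_, ?_⟩, ?_⟩ <;> refine Measure.ae_smul_measure ?_ _ <;>
    rw [ae_dirac_iff (p := fun x => x ∈ Icc S.Tmin S.Tmax) measurableSet_Icc] <;> simp [Tmin, Tmax]

/-- The law of the sequence of the lengths of consecutive vacations. -/
abbrev vacationsLaw : Measure (ℕ → ℝ) := Measure.infinitePi fun _ : ℕ => S.slotLaw

lemma ae_vacationsLaw_mem_Icc : ∀ᵐ v ∂S.vacationsLaw, ∀ k, v k ∈ Icc S.Tmin S.Tmax :=
  ae_infinitePi_forall fun _ => S.ae_slotLaw_mem_Icc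

lemma ae_vacationsLaw_exists_le_sum :
    ∀ᵐ v ∂S.vacationsLaw, ∀ u, ∃ n, u ≤ ∑ k ∈ Finset.range n, v k :=
  S.ae_vacationsLaw_mem_Icc.mono fun _ hv => exists_le_sum_range S.Tmin_pos fun k => (hv k).1

lemma ae_backoffLaw_lt (i : ℕ) : ∀ᵐ n ∂S.backoffLaw i, n < S.window i := by
  have mass_eq_one : S.backoffLaw i (Iio (S.window i)) = 1 :=
    uniformOn_self (finite_Iio _) ⟨0, S.window_pos i⟩
  exact (prob_compl_eq_zero_iff measurableSet_Iio).mpr mass_eq_one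

/-- The joint law of the backoff counters and the slot lengths. -/
def counterLaw : Measure ((ℕ → ℕ) × (ℕ → ℕ → ℝ)) :=
  (Measure.infinitePi S.backoffLaw).prod
    (Measure.infinitePi fun _ : ℕ => Measure.infinitePi fun _ : ℕ => S.slotLaw)

instance : IsProbabilityMeasure S.counterLaw := by
  unfold counterLaw
  infer_instance

lemma ae_counterLaw_lt_window : ∀ᵐ q ∂S.counterLaw, ∀ i, q.1 i < S.window i :=
  Measure.quasiMeasurePreserving_fst.ae (ae_infinitePi_forall S.ae_backoffLaw_lt)

lemma ae_counterLaw_mem_Icc : ∀ᵐ q ∂S.counterLaw, ∀ i m, q.2 i m ∈ Icc S.Tmin S.Tmax :=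
  Measure.quasiMeasurePreserving_snd.ae (ae_infinitePi_forall fun _ => S.ae_vacationsLaw_mem_Icc)

lemma lintegral_failureLaw (f : ℕ → ℝ≥0∞) :
    ∫⁻ j, f j ∂S.failureLaw = ∑' j, ENNReal.ofReal (S.pc ^ j * (1 - S.pc)) * f j := by
  have pc_lt_one : S.pc < 1 := S.collisionProb_lt_one
  rw [failureLaw, geometricMeasure_eq (by
    simpa [Subtype.ext_iff] using (sub_pos.mpr pc_lt_one).ne'), lintegral_sum_measure]
  simp [lintegral_smul_measure]

lemma posMoment_accessLaw (k : ℕ) :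
    posMoment S.accessLaw k = ∑' j, ENNReal.ofReal (S.pc ^ j * (1 - S.pc)) *
      ∫⁻ q, ENNReal.ofReal (S.accessDelay j q.1 q.2) ^ k ∂S.counterLaw := by
  have measurable_delay := S.measurable_accessDelay
  rw [posMoment, accessLaw, lintegral_map (by fun_prop) measurable_delay,
    lintegral_prod _ (by fun_prop), lintegral_failureLaw]
  rfl

lemma window_le (i : ℕ) : (S.window i : ℝ) ≤ (S.W₀ + 1) * S.r ^ i := by
  have one_le_pow : 1 ≤ S.r ^ i := one_le_pow₀ S.one_lt_r.le
  linarith [(abs_lt.mp (S.window_spec i)).2]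

lemma le_window (i : ℕ) : S.r ^ i / 2 ≤ S.window i := by
  have one_le_window : (1 : ℝ) ≤ S.window i := by exact_mod_cast S.window_pos i
  have one_le_W₀ : (1 : ℝ) ≤ S.W₀ := by exact_mod_cast S.W₀_pos
  have pow_le : S.r ^ i ≤ S.r ^ i * S.W₀ :=
    le_mul_of_one_le_right (pow_nonneg (zero_le_one.trans S.one_lt_r.le) i) one_le_W₀
  linarith [(abs_lt.mp (S.window_spec i)).1]

lemma sum_backoff_le {i n : ℕ} {l : ℕ → ℝ} (hn : n < S.window i) (hl : ∀ m, l m ≤ S.Tmax) :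
    ∑ m ∈ Finset.range n, l m ≤ S.Tmax * (S.W₀ + 1) * S.r ^ i := by
  have Tmax_pos := S.Tmax_pos
  have n_le : (n : ℝ) ≤ (S.W₀ + 1) * S.r ^ i :=
    le_trans (by exact_mod_cast hn.le) (S.window_le i)
  calc ∑ m ∈ Finset.range n, l m ≤ n * S.Tmax := by
        simpa using Finset.sum_le_card_nsmul (Finset.range n) l S.Tmax fun m _ => hl m
    _ ≤ (S.W₀ + 1) * S.r ^ i * S.Tmax := by gcongr
    _ = S.Tmax * (S.W₀ + 1) * S.r ^ i := by ring

lemma exists_accessDelay_le : ∃ C > 0, ∀ (j : ℕ) (b : ℕ → ℕ) (l : ℕ → ℕ → ℝ),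
    (∀ i, b i < S.window i) → (∀ i m, l i m ≤ S.Tmax) → S.accessDelay j b l ≤ C * S.r ^ j := by
  have Tmax_pos := S.Tmax_pos
  have Tcoll_pos := S.Tcoll_pos
  have Tsucc_pos := S.Tsucc_pos
  have r_pos : 0 < S.r := zero_lt_one.trans S.one_lt_r
  have r_sub_one_pos : 0 < S.r - 1 := sub_pos.mpr S.one_lt_r
  set K := S.Tmax * (S.W₀ + 1) + S.Tcoll + S.Tsucc with K_def
  refine ⟨K * (S.r / (S.r - 1)), by positivity, fun j b l hb hl => ?_⟩
  calc S.accessDelay j b l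
      ≤ ∑ i ∈ Finset.range (j + 1), (S.Tmax * (S.W₀ + 1) * S.r ^ i + S.Tcoll + S.Tsucc) := by
        simp only [Finset.sum_add_distrib, Finset.sum_const, Finset.card_range, nsmul_eq_mul,
          Nat.cast_add_one, add_mul, one_mul]
        have backoffs_le := Finset.sum_le_sum fun i (_ : i ∈ Finset.range (j + 1)) =>
          S.sum_backoff_le (hb i) (hl i)
        have succ_nonneg : 0 ≤ j * S.Tsucc := by positivity
        rw [accessDelay]
        linarith
    _ ≤ ∑ i ∈ Finset.range (j + 1), K * S.r ^ i := by
        refine Finset.sum_le_sum fun i _ => ?_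
        have one_le_pow : 1 ≤ S.r ^ i := one_le_pow₀ S.one_lt_r.le
        rw [K_def, add_mul, add_mul]
        gcongr <;> exact le_mul_of_one_le_right (by positivity) one_le_pow
    _ = K * ∑ i ∈ Finset.range (j + 1), S.r ^ i := (Finset.mul_sum _ _ _).symm
    _ ≤ K * (S.r / (S.r - 1) * S.r ^ j) := by
        gcongr
        exact sum_range_pow_le S.one_lt_r j
    _ = K * (S.r / (S.r - 1)) * S.r ^ j := (mul_assoc _ _ _).symm

lemma le_accessDelay {j : ℕ} {b : ℕ → ℕ} {l : ℕ → ℕ → ℝ} (hl : ∀ i m, S.Tmin ≤ l i m) :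
    S.Tmin * (b j + 1) ≤ S.accessDelay j b l := by
  have last_period_le : ∑ m ∈ Finset.range (b j), l j m ≤
      ∑ i ∈ Finset.range (j + 1), ∑ m ∈ Finset.range (b i), l i m :=
    Finset.single_le_sum (f := fun i => ∑ m ∈ Finset.range (b i), l i m)
      (fun i _ => Finset.sum_nonneg fun m _ => S.Tmin_pos.le.trans (hl i m))
      (Finset.self_mem_range_succ j)
  have le_last_period : b j * S.Tmin ≤ ∑ m ∈ Finset.range (b j), l j m := by
    simpa using Finset.card_nsmul_le_sum (Finset.range (b j)) (l j) S.Tmin fun m _ => hl j m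
  have coll_nonneg : 0 ≤ j * S.Tcoll := mul_nonneg j.cast_nonneg S.Tcoll_pos.le
  rw [accessDelay]
  linarith [S.Tmin_le_Tsucc]

lemma ae_nonneg_accessLaw : ∀ᵐ x ∂S.accessLaw, 0 ≤ x := by
  rw [accessLaw, ae_map_iff S.measurable_accessDelay.aemeasurable measurableSet_Ici]
  have ae_slots : ∀ᵐ ω ∂S.failureLaw.prod S.counterLaw, ∀ i m, ω.2.2 i m ∈ Icc S.Tmin S.Tmax :=
    Measure.quasiMeasurePreserving_snd.ae S.ae_counterLaw_mem_Icc
  filter_upwards [ae_slots] with ω hω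
  exact (mul_nonneg S.Tmin_pos.le (by positivity)).trans (S.le_accessDelay fun i m => (hω i m).1)

lemma le_lintegral_backoffLaw (j k : ℕ) :
    ENNReal.ofReal (S.Tmin / 4 * S.r ^ j) ^ k * (1 / 2) ≤
      ∫⁻ n, ENNReal.ofReal (S.Tmin * (n + 1)) ^ k ∂S.backoffLaw j := by
  refine le_trans ?_ (mul_meas_ge_le_lintegral (by fun_prop)
    (ENNReal.ofReal (S.Tmin / 4 * S.r ^ j) ^ k))
  gcongr
  refine (half_le_uniformOn_Iio (S.window_pos j)).trans (measure_mono fun n hn => ?_)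
  have window_le_two_mul : (S.window j : ℝ) ≤ 2 * (n + 1) := by
    have : S.window j / 2 ≤ n := hn
    exact_mod_cast (by omega : S.window j ≤ 2 * (n + 1))
  have pow_le_counter : S.Tmin / 4 * S.r ^ j ≤ S.Tmin * (n + 1) := by
    nlinarith [S.le_window j, S.Tmin_pos]
  exact pow_le_pow_left' (ENNReal.ofReal_le_ofReal pow_le_counter) k

lemma le_lintegral_accessDelay (j k : ℕ) :
    ENNReal.ofReal (S.Tmin / 4 * S.r ^ j) ^ k * (1 / 2) ≤
      ∫⁻ q, ENNReal.ofReal (S.accessDelay j q.1 q.2) ^ k ∂S.counterLaw := by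
  have last_counter : MeasurePreserving (fun q : (ℕ → ℕ) × (ℕ → ℕ → ℝ) => q.1 j) S.counterLaw
      (S.backoffLaw j) :=
    (measurePreserving_eval_infinitePi S.backoffLaw j).comp measurePreserving_fst
  refine (S.le_lintegral_backoffLaw j k).trans ?_
  rw [← last_counter.lintegral_comp (f := fun n : ℕ => ENNReal.ofReal (S.Tmin * (n + 1)) ^ k)
    (by fun_prop)]
  refine lintegral_mono_ae ?_
  filter_upwards [S.ae_counterLaw_mem_Icc] with q hq
  gcongr
  exact S.le_accessDelay fun i m => (hq i m).1

lemma posMoment_accessLaw_lt_top_iff (k : ℕ) :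
    posMoment S.accessLaw k < ∞ ↔ S.pc * S.r ^ k < 1 := by
  have geometric_iff {C : ℝ} (hC : 0 < C) := tsum_geometric_mul_pow_lt_top_iff S.pc_nonneg
    S.collisionProb_lt_one (zero_le_one.trans S.one_lt_r.le) hC k
  rw [posMoment_accessLaw]
  constructor
  · intro h
    rw [← geometric_iff (div_pos S.Tmin_pos four_pos)]
    refine ENNReal.lt_top_of_mul_ne_top_left (b := 1 / 2) (ne_top_of_le_ne_top h.ne ?_) (by simp)
    rw [← ENNReal.tsum_mul_right]
    refine ENNReal.tsum_le_tsum fun j => ?_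
    rw [mul_assoc]
    exact mul_le_mul_right (S.le_lintegral_accessDelay j k) _
  · intro h
    obtain ⟨C, hC, delay_le⟩ := S.exists_accessDelay_le
    refine lt_of_le_of_lt (ENNReal.tsum_le_tsum fun j => ?_) ((geometric_iff hC).mpr h)
    gcongr
    calc ∫⁻ q, ENNReal.ofReal (S.accessDelay j q.1 q.2) ^ k ∂S.counterLaw
        ≤ ∫⁻ _, ENNReal.ofReal (C * S.r ^ j) ^ k ∂S.counterLaw := by
          refine lintegral_mono_ae ?_
          filter_upwards [S.ae_counterLaw_lt_window, S.ae_counterLaw_mem_Icc] with q hb hl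
          gcongr
          exact delay_le j q.1 q.2 hb fun i m => (hl i m).2
      _ = ENNReal.ofReal (C * S.r ^ j) ^ k := by simp

lemma rhoTilde_eq_delayKernel_univ : S.rhoTilde = delayKernel S.rate S.accessLaw univ := by
  rw [delayKernel_univ S.ae_nonneg_accessLaw, posMoment_one, rhoTilde]

lemma posMoment_residualLaw_lt_top (k : ℕ) :
    posMoment (residualLaw S.rate S.vacationsLaw) k < ∞ :=
  have := isProbabilityMeasure_residualLaw (V := S.vacationsLaw) S.rate_pos
  posMoment_lt_top_of_ae_le (ae_residualLaw_le S.rate_pos S.Tmax_pos.le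
    (S.ae_vacationsLaw_mem_Icc.mono fun _ hv k => (hv k).2)) k

lemma isSteadyStateDelay_iff {μ : Measure ℝ} : S.IsSteadyStateDelay μ ↔
    S.rhoTilde < 1 ∧ μ = delayLaw S.rate S.accessLaw S.vacationsLaw := by
  have hX := S.ae_nonneg_accessLaw
  have hV := S.ae_vacationsLaw_exists_le_sum
  have hR := ae_nonneg_residualLaw S.rate_pos hV
  have hR1 := S.posMoment_residualLaw_lt_top 1
  rw [rhoTilde_eq_delayKernel_univ]
  constructor
  · intro h
    have := h.isProbabilityMeasure
    exact eq_delayLaw_of_nextDelayLaw_eq_self S.rate_pos hX hV hR1 h.nonneg h.stationary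
  · rintro ⟨hρ, rfl⟩
    exact ⟨isProbabilityMeasure_delayLaw S.rate_pos hX hR hR1 hρ,
      ae_nonneg_delayLaw S.rate_pos hX hR, nextDelayLaw_delayLaw S.rate_pos hX hV hR1 hρ⟩

lemma exists_isSteadyStateDelay_posMoment_lt_top_iff (k : ℕ) :
    (∃ μ, S.IsSteadyStateDelay μ ∧ posMoment μ k < ∞) ↔
      S.rhoTilde < 1 ∧ S.pc < 1 / S.r ^ (k + 1) := by
  have hR := ae_nonneg_residualLaw S.rate_pos S.ae_vacationsLaw_exists_le_sum
  have moment_iff (hρ : S.rhoTilde < 1) := posMoment_delayLaw_lt_top_iff S.rate_pos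
    S.ae_nonneg_accessLaw hR (S.posMoment_residualLaw_lt_top (k + 1))
    (S.rhoTilde_eq_delayKernel_univ ▸ hρ)
  simp only [isSteadyStateDelay_iff, and_assoc, exists_and_left, exists_eq_left]
  refine and_congr_right fun hρ => ?_
  rw [moment_iff hρ, posMoment_accessLaw_lt_top_iff,
    lt_div_iff₀ (pow_pos (zero_lt_one.trans S.one_lt_r) _)]

end Network

end MPRWLAN

end

theorem theorem3 (S : MPRWLAN.Network) :
    -- the steady-state delay `D` exists if and only if `ρ̃ < 1`, and its law is unique
    ((∃ μ, S.IsSteadyStateDelay μ) ↔ S.rhoTilde < 1) ∧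
    (∀ μ ν, S.IsSteadyStateDelay μ → S.IsSteadyStateDelay ν → μ = ν) ∧
    -- it has a finite mean if and only if `ρ̃ < 1` and `p_c < 1 / r ^ 2`
    ((∃ μ, S.IsSteadyStateDelay μ ∧ ∫⁻ d, ENNReal.ofReal d ∂μ < ∞) ↔
      S.rhoTilde < 1 ∧ S.pc < 1 / S.r ^ 2) ∧
    -- it has a finite variance if and only if `ρ̃ < 1` and `p_c < 1 / r ^ 3`
    ((∃ μ, S.IsSteadyStateDelay μ ∧ evariance (fun d : ℝ => d) μ < ∞) ↔
      S.rhoTilde < 1 ∧ S.pc < 1 / S.r ^ 3) := by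
  refine ⟨?_, fun μ ν hμ hν => ?_, ?_, ?_⟩
  · simp only [S.isSteadyStateDelay_iff, exists_and_left, exists_eq, and_true]
  · exact (S.isSteadyStateDelay_iff.mp hμ).2.trans (S.isSteadyStateDelay_iff.mp hν).2.symm
  · simpa only [MPRWLAN.posMoment_one] using S.exists_isSteadyStateDelay_posMoment_lt_top_iff 1
  · rw [← S.exists_isSteadyStateDelay_posMoment_lt_top_iff 2]
    refine exists_congr fun μ => and_congr_right fun hμ => ?_
    have := hμ.isProbabilityMeasure
    exact MPRWLAN.evariance_id_lt_top_iff hμ.nonneg
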